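/- For every $n\ge 1$ let $Y_n=(y_{ij})_{1\le i,j\le n}$ be an $n\times n$ random matrix with independent standard normal entries $y_{ij}\sim N(0,1)$ and columns $\mathbf y_1,\dots,\mathbf y_n$. Let $\Gamma_n=(\gamma_{ij})$ be the $n\times n$ matrix whose columns $\boldsymbol\gamma_1,\dots,\boldsymbol\gamma_n$ are produced by the Gram–Schmidt algorithm: $\mathbf w_k=\mathbf y_k-\sum_{i<k}\langle \mathbf y_k,\boldsymbol\gamma_i\rangle\boldsymbol\gamma_i$ and $\boldsymbol\gamma_k=\mathbf w_k/\|\mathbf w_k\|$ for $k=1,\dots,n$ (this is almost surely well defined). Then $\Gamma_n$ is distributed according to the Haar probability measure on the orthogonal group $O(n)$. For $1\le p,q\le n$ let $\Gamma_{p\times q}$ and $Y_{p\times q}$ be the upper-left $p\times q$ blocks of $\Gamma_n$ and $Y_n$, and put $$\|\sqrt n\,\Gamma_{p\times q}-Y_{p\times q}\|_{\rm HS}=\Big(\sum_{i=1}^p\sum_{j=1}^q(\sqrt n\,\gamma_{ij}-y_{ij})^2\Big)^{1/2}.$$ Let $p=p_n$ and $q=q_n$ be integers with $1\le p_n,q_n\le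 n$ for all $n\ge1$. (i) If $\lim_{n\to\infty}pq^2/n=0$, then $\|\sqrt n\,\Gamma_{p\times q}-Y_{p\times q}\|_{\rm HS}\to0$ in probability as $n\to\infty$. (ii) If $\lim_{n\to\infty}pq^2/n=\sigma\in(0,\infty)$, then for every $\epsilon<\sqrt{\sigma/2}$ $$\liminf_{n\to\infty}P\big(\|\sqrt n\,\Gamma_{p\times q}-Y_{p\times q}\|_{\rm HS}\ge\epsilon\big)>0 .$$ (iii) If $\lim_{n\to\infty}pq^2/n=\sigma\in(0,\infty)$ and moreover $q_n\to\infty$, then $\|\sqrt n\,\Gamma_{p\times q}-Y_{p\times q}\|_{\rm HS}\to\sqrt{\sigma/2}$ in probability as $n\to\infty$. -/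

import Mathlib

open MeasureTheory ProbabilityTheory Filter Topology

namespace GaussOrth

/-- `Y` is an `n × n` random matrix whose entries are i.i.d. standard normal variables. -/
structure IsGaussianMatrix {Ω : Type*} [MeasurableSpace Ω] (P : Measure Ω) {n : ℕ}
    (Y : Ω → Matrix (Fin n) (Fin n) ℝ) : Prop where
  /-- every entry has the law `N(0,1)` -/
  hasLaw : ∀ i j, HasLaw (fun ω => Y ω i j) (gaussianReal 0 1) P
  /-- all the entries are mutually independent -/
  indep : iIndepFun (fun (ij : Fin n × Fin n) ω => Y ω ij.1 ij.2) P

/-- The `j`-th column of a square matrix as a vector of Euclidean space. -/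
noncomputable def column {n : ℕ} (A : Matrix (Fin n) (Fin n) ℝ) (j : Fin n) :
    EuclideanSpace ℝ (Fin n) :=
  WithLp.toLp 2 (fun i => A i j)

/-- The matrix whose columns are obtained from those of `A`, from left to right, by the
Gram-Schmidt algorithm with normalization. -/
noncomputable def gramSchmidtMatrix {n : ℕ} (A : Matrix (Fin n) (Fin n) ℝ) :
    Matrix (Fin n) (Fin n) ℝ :=
  Matrix.of fun i j => InnerProductSpace.gramSchmidtNormed ℝ (column A) j i

/-- Real matrices carry the product (equivalently Borel) sigma-algebra. -/
instance instMeasurableSpaceMatrix {m n : ℕ} : MeasurableSpace (Matrix (Fin m) (Fin n) ℝ) :=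
  inferInstanceAs (MeasurableSpace (Fin m → Fin n → ℝ))

/-- A measure on `n × n` matrices is the uniform distribution on the orthogonal group when it is
the image, under the inclusion, of a Haar probability measure on `O(n)`. -/
def IsHaarOrthogonalLaw {n : ℕ} (m : Measure (Matrix (Fin n) (Fin n) ℝ)) : Prop :=
  ∃ ν : Measure (Matrix.orthogonalGroup (Fin n) ℝ),
    ν.IsHaarMeasure ∧ IsProbabilityMeasure ν ∧ m = ν.map Subtype.val

/-- The upper-left `p × q` block of an `n × n` matrix. -/
def upperLeft {n p q : ℕ} (hp : p ≤ n) (hq : q ≤ n) (A : Matrix (Fin n) (Fin n) ℝ) :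
    Matrix (Fin p) (Fin q) ℝ :=
  A.submatrix (Fin.castLE hp) (Fin.castLE hq)

/-- The Hilbert-Schmidt norm of a real matrix. -/
noncomputable def hsNorm {p q : ℕ} (A : Matrix (Fin p) (Fin q) ℝ) : ℝ :=
  √(∑ i, ∑ j, A i j ^ 2)

/-- For an `n × n` matrix `A` with Gram-Schmidt matrix `Γ`, the Hilbert-Schmidt norm of the
difference of the upper-left `p × q` blocks of `√n Γ` and `A`. -/
noncomputable def blockDist {n p q : ℕ} (hp : p ≤ n) (hq : q ≤ n)
    (A : Matrix (Fin n) (Fin n) ℝ) : ℝ :=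
  hsNorm (√(n : ℝ) • upperLeft hp hq (gramSchmidtMatrix A) - upperLeft hp hq A)

end GaussOrth

/-!
Write `R j` for the length of the `j`-th Gram-Schmidt vector before normalization, `γ j` for the
normalized vector and `P j` for the projection to the span of the columns preceding the `j`-th one,
so that `y j = R j • γ j + P j (y j)`. Hence the `j`-th column of `√n Γ - Y` is
`(√n - R j) • γ j - P j (y j)` (`entry_eq`), and the squared Hilbert-Schmidt distance of the `p × q`
blocks is, up to a cross term, the sum of `projPart = ∑ j, |P j (y j)|²` and
`defectPart = ∑ j, (√n - R j)² |γ j|²`, with norms taken over the first `p` rows. The first part is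
about `p q² / (2 n)` and carries the limit. The second has expectation at most a constant times
`p q / n` when `p q² / n` is bounded, which is negligible once `q → ∞`.

All expectations are taken over the law `columnLaw n` of `n` independent standard Gaussian columns,
and three facts drive the computation.

* Independence: replacing the `j`-th column by an independent copy preserves the law
  (`measurePreserving_update`), so one may integrate over the `j`-th column with the others fixed
  (`integral_columnLaw_eq`). For fixed preceding columns, `R j ^ 2` is chi-squared with `n - j`
  degrees of freedom (indices start at `0`), `P j (y j)` is Gaussian on a subspace with moments given
  by the Wick formula, and reflecting that subspace shows that the cross term has mean zero.
* Rotation invariance: a common rotation of the columns rotates the vectors `γ j`, preserves the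
  lengths `R j` and preserves the law (`measurePreserving_rotate`). This determines the second
  moments of the entries of the projections, because the moment of a quadratic form in a unit vector
  does not depend on the vector, and the trace and the Hilbert-Schmidt norm of a projection are known
  (`exists_gramEntry_moments`).
* The martingale structure: `|P j (y j)|²` minus its conditional expectation given the preceding
  columns is a martingale difference, which yields the variance of `projPart`
  (`integral_projPart_sub_sq_le`).

If `p q² / n → 0`, the expected squared distance tends to `0` and Markov's inequality applies. If
`p q² / n → σ`, that expectation has lower limit at least `σ / 2` (`le_integral_distSq_ratio`) and
the second moment stays bounded, so the Paley-Zygmund inequality keeps the probability of exceeding a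
level below `√(σ / 2)` away from `0`. If moreover `q → ∞`, then `projPart → σ / 2` by Chebyshev's
inequality and `defectPart → 0` by Markov's inequality.

The law of `Γ` is Haar measure because it is a probability measure on the compact group `O(n)` which
is left invariant, again by rotation invariance (`isHaarOrthogonalLaw_orthoMatrix`).
-/

namespace GaussOrth

open scoped RealInnerProductSpace

/-! ### Functions with finite moments of all orders -/

/-- The real function `f` has finite absolute moments of every order with respect to `μ`. -/
def HasMoments {α : Type*} {_ : MeasurableSpace α} (f : α → ℝ) (μ : Measure α) : Prop :=
  ∀ r : ℕ, MemLp f r μ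

section HasMoments

variable {α : Type*} {_ : MeasurableSpace α} {μ : Measure α} {f g : α → ℝ}

theorem HasMoments.integrable (hf : HasMoments f μ) : Integrable f μ :=
  memLp_one_iff_integrable.1 (by simpa using hf 1)

theorem HasMoments.aestronglyMeasurable (hf : HasMoments f μ) : AEStronglyMeasurable f μ :=
  hf.integrable.aestronglyMeasurable

theorem hasMoments_const [IsFiniteMeasure μ] (a : ℝ) : HasMoments (fun _ : α => a) μ :=
  fun _ => memLp_const a

theorem HasMoments.add (hf : HasMoments f μ) (hg : HasMoments g μ) :
    HasMoments (fun x => f x + g x) μ := fun r => (hf r).add (hg r)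

theorem HasMoments.sub (hf : HasMoments f μ) (hg : HasMoments g μ) :
    HasMoments (fun x => f x - g x) μ := fun r => (hf r).sub (hg r)

theorem HasMoments.const_mul (hf : HasMoments f μ) (a : ℝ) :
    HasMoments (fun x => a * f x) μ := fun r => (hf r).const_mul a

/-- The product is controlled by Hölder's inequality, at the expense of moments of twice the
order. -/
theorem HasMoments.mul [IsFiniteMeasure μ] (hf : HasMoments f μ) (hg : HasMoments g μ) :
    HasMoments (fun x => f x * g x) μ := by
  intro r
  rcases Nat.eq_zero_or_pos r with rfl | hr
  · rw [Nat.cast_zero, memLp_zero_iff_aestronglyMeasurable]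
    exact hf.aestronglyMeasurable.mul hg.aestronglyMeasurable
  · have : ENNReal.HolderTriple ((2 * r : ℕ) : ENNReal) ((2 * r : ℕ) : ENNReal) (r : ENNReal) := by
      constructor
      have h2 : (r : ENNReal)⁻¹ ≠ ⊤ := by simp [hr.ne']
      push_cast
      rw [ENNReal.mul_inv (by simp) (by simp), ← add_mul, ENNReal.inv_two_add_inv_two, one_mul]
    exact (hg (2 * r)).mul (hf (2 * r))

theorem HasMoments.pow [IsFiniteMeasure μ] (hf : HasMoments f μ) (k : ℕ) :
    HasMoments (fun x => f x ^ k) μ := by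
  induction k with
  | zero => simpa using hasMoments_const (μ := μ) (1 : ℝ)
  | succ k ih => simpa only [pow_succ] using ih.mul hf

theorem HasMoments.sum [IsFiniteMeasure μ] {ι : Type*} (s : Finset ι) {F : ι → α → ℝ}
    (hF : ∀ i ∈ s, HasMoments (F i) μ) : HasMoments (fun x => ∑ i ∈ s, F i x) μ :=
  fun r => memLp_finsetSum s fun i hi => hF i hi r

theorem HasMoments.mono (hg : HasMoments g μ) (hf : AEStronglyMeasurable f μ)
    (h : ∀ᵐ x ∂μ, |f x| ≤ g x) : HasMoments f μ := by
  intro r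
  refine (hg r).mono hf ?_
  filter_upwards [h] with x hx
  exact hx.trans (le_abs_self _)

theorem HasMoments.comp {β : Type*} {_ : MeasurableSpace β} {ν : Measure β} {h : β → α}
    (hf : HasMoments f μ) (hh : MeasurePreserving h ν μ) : HasMoments (fun x => f (h x)) ν :=
  fun r => (hf r).comp_measurePreserving hh

theorem HasMoments.integral_add (hf : HasMoments f μ) (hg : HasMoments g μ) :
    ∫ x, (f x + g x) ∂μ = ∫ x, f x ∂μ + ∫ x, g x ∂μ :=
  MeasureTheory.integral_add hf.integrable hg.integrable

theorem HasMoments.integral_sub (hf : HasMoments f μ) (hg : HasMoments g μ) :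
    ∫ x, (f x - g x) ∂μ = ∫ x, f x ∂μ - ∫ x, g x ∂μ :=
  MeasureTheory.integral_sub hf.integrable hg.integrable

theorem HasMoments.integral_sum {ι : Type*} (s : Finset ι) {F : ι → α → ℝ}
    (hF : ∀ i ∈ s, HasMoments (F i) μ) :
    ∫ x, ∑ i ∈ s, F i x ∂μ = ∑ i ∈ s, ∫ x, F i x ∂μ :=
  integral_finsetSum s fun i hi => (hF i hi).integrable

end HasMoments

/-! ### Moments of Gaussian vectors -/

theorem integral_pow_even_gaussianReal (k : ℕ) :
    ∫ x, x ^ (2 * k) ∂(gaussianReal 0 1) = ((2 * k - 1 : ℕ).doubleFactorial : ℝ) := by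
  rw [integral_gaussianReal_eq_integral_smul (by simp)]
  have h1 : ∀ x : ℝ, gaussianPDFReal 0 1 x • x ^ (2 * k)
      = (√(2 * Real.pi))⁻¹ * (|x| ^ ((2 * k : ℕ) : ℝ) * Real.exp (-(1 / 2) * |x| ^ (2 : ℝ))) := by
    intro x
    have e1 : |x| ^ ((2 * k : ℕ) : ℝ) = x ^ (2 * k) := by
      rw [Real.rpow_natCast, pow_mul, pow_mul, sq_abs]
    have e2 : |x| ^ (2 : ℝ) = x ^ 2 := by
      rw [← sq_abs x]; exact_mod_cast Real.rpow_natCast |x| 2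
    rw [e1, e2, gaussianPDFReal]
    simp only [NNReal.coe_one, mul_one, sub_zero, smul_eq_mul]
    rw [show -x ^ 2 / 2 = -(1 / 2) * x ^ 2 by ring]
    ring
  simp_rw [h1]
  rw [integral_const_mul,
    integral_comp_abs (f := fun x => x ^ ((2 * k : ℕ) : ℝ) * Real.exp (-(1 / 2) * x ^ (2 : ℝ))),
    integral_rpow_mul_exp_neg_mul_rpow (by norm_num)
      (lt_of_lt_of_le (by norm_num) (Nat.cast_nonneg _)) (by norm_num)]
  have e3 : (((2 * k : ℕ) : ℝ) + 1) / 2 = k + 1 / 2 := by push_cast; ring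
  have e4 : (1 / 2 : ℝ) ^ (-(((2 * k : ℕ) : ℝ) + 1) / 2) = 2 ^ k * √2 := by
    rw [neg_div, e3, one_div, Real.inv_rpow (by norm_num), Real.rpow_neg (by norm_num), inv_inv,
      Real.rpow_add (by norm_num), Real.rpow_natCast, Real.sqrt_eq_rpow, one_div]
  have hpi := Real.sqrt_pos.2 Real.pi_pos
  rw [e3, e4, Real.Gamma_nat_add_half, Real.sqrt_mul (by norm_num)]
  field_simp

theorem hasMoments_id_gaussianReal : HasMoments (fun x => x) (gaussianReal 0 1) :=
  fun r => by exact_mod_cast memLp_id_gaussianReal (μ := 0) (v := 1) (r : NNReal)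

section Vector

variable {E : Type*} [NormedAddCommGroup E] [InnerProductSpace ℝ E] [FiniteDimensional ℝ E]
  [MeasurableSpace E] [BorelSpace E]

theorem map_inner_stdGaussian (u : E) :
    (stdGaussian E).map (fun y => ⟪u, y⟫) = (gaussianReal 0 1).map (fun x => ‖u‖ * x) := by
  have h := IsGaussian.map_eq_gaussianReal (μ := stdGaussian E) (innerSL ℝ u)
  rw [integral_strongDual_stdGaussian, variance_dual_stdGaussian, innerSL_apply_norm] at h
  rw [gaussianReal_map_const_mul]
  refine (h.trans ?_)
  congr 1
  · simp
  · ext; simp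

theorem hasMoments_inner_stdGaussian (u : E) : HasMoments (fun y => ⟪u, y⟫) (stdGaussian E) := by
  intro r
  have h : MemLp (fun x : ℝ => x) r ((stdGaussian E).map (fun y => ⟪u, y⟫)) := by
    rw [map_inner_stdGaussian]
    exact (memLp_map_measure_iff (by fun_prop) (by fun_prop)).2
      (hasMoments_id_gaussianReal.const_mul ‖u‖ r)
  exact (memLp_map_measure_iff (f := fun y => ⟪u, y⟫) (by fun_prop) (by fun_prop)).1 h

theorem integral_inner_pow_stdGaussian (u : E) (k : ℕ) :
    ∫ y, ⟪u, y⟫ ^ (2 * k) ∂(stdGaussian E)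
      = ‖u‖ ^ (2 * k) * ((2 * k - 1 : ℕ).doubleFactorial : ℝ) := by
  have h := integral_map (μ := stdGaussian E) (φ := fun y => ⟪u, y⟫) (by fun_prop)
    (f := fun x : ℝ => x ^ (2 * k)) (by fun_prop)
  rw [← h, map_inner_stdGaussian, integral_map (by fun_prop) (by fun_prop),
    ← integral_pow_even_gaussianReal, ← integral_const_mul]
  simp_rw [mul_pow]

theorem integral_inner_sq_stdGaussian (u : E) :
    ∫ y, ⟪u, y⟫ ^ 2 ∂(stdGaussian E) = ‖u‖ ^ 2 := by
  simpa using integral_inner_pow_stdGaussian u 1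

/-- The fourth order Wick formula, obtained by polarization of the fourth moment. -/
theorem integral_inner_sq_mul_inner_sq_stdGaussian (u v : E) :
    ∫ y, ⟪u, y⟫ ^ 2 * ⟪v, y⟫ ^ 2 ∂(stdGaussian E) = ‖u‖ ^ 2 * ‖v‖ ^ 2 + 2 * ⟪u, v⟫ ^ 2 := by
  have h4 : ∀ w : E, ∫ y, ⟪w, y⟫ ^ 4 ∂(stdGaussian E) = 3 * ‖w‖ ^ 4 := by
    intro w
    have := integral_inner_pow_stdGaussian w 2
    norm_num [Nat.doubleFactorial] at this
    linarith
  have e : ∀ y : E, ⟪u, y⟫ ^ 2 * ⟪v, y⟫ ^ 2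
      = (1 / 12) * ((⟪u + v, y⟫ ^ 4 + ⟪u - v, y⟫ ^ 4) - 2 * (⟪u, y⟫ ^ 4 + ⟪v, y⟫ ^ 4)) := by
    intro y
    rw [inner_add_left, inner_sub_left]
    ring
  have hi : ∀ w : E, HasMoments (fun y => ⟪w, y⟫ ^ 4) (stdGaussian E) :=
    fun w => ((hasMoments_inner_stdGaussian w).pow 4)
  simp_rw [e]
  rw [integral_const_mul, HasMoments.integral_sub ((hi _).add (hi _)) (((hi _).add (hi _)).const_mul 2),
    integral_const_mul, HasMoments.integral_add (hi _) (hi _), HasMoments.integral_add (hi _) (hi _)]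
  simp_rw [h4]
  have n1 := norm_add_sq_real u v
  have n2 := norm_sub_sq_real u v
  have p : ∀ w : E, ‖w‖ ^ 4 = (‖w‖ ^ 2) ^ 2 := fun w => by ring
  rw [p, p, n1, n2]
  ring

end Vector

/-! ### Moments of the chi-squared distribution -/

section ChiSq

variable {ι : Type*} [Fintype ι]

theorem hasMoments_eval_pi (i : ι) :
    HasMoments (fun x : ι → ℝ => x i) (Measure.pi fun _ : ι => gaussianReal 0 1) :=
  hasMoments_id_gaussianReal.comp (measurePreserving_eval _ i)

/-- The centred chi-squared variable formed from the coordinates in `s`. -/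
def chiSqCentred (s : Finset ι) (x : ι → ℝ) : ℝ := ∑ i ∈ s, (x i ^ 2 - 1)

theorem hasMoments_chiSqCentred (s : Finset ι) :
    HasMoments (chiSqCentred s) (Measure.pi fun _ : ι => gaussianReal 0 1) :=
  HasMoments.sum s fun i _ => ((hasMoments_eval_pi i).pow 2).sub (hasMoments_const 1)

theorem integral_sq_sub_one_pow :
    ∫ x : ℝ, (x ^ 2 - 1) ∂(gaussianReal 0 1) = 0 ∧
    ∫ x : ℝ, (x ^ 2 - 1) ^ 2 ∂(gaussianReal 0 1) = 2 ∧
    ∫ x : ℝ, (x ^ 2 - 1) ^ 3 ∂(gaussianReal 0 1) = 8 ∧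
    ∫ x : ℝ, (x ^ 2 - 1) ^ 4 ∂(gaussianReal 0 1) = 60 := by
  have m2 := integral_pow_even_gaussianReal 1
  have m4 := integral_pow_even_gaussianReal 2
  have m6 := integral_pow_even_gaussianReal 3
  have m8 := integral_pow_even_gaussianReal 4
  norm_num [Nat.doubleFactorial] at m2 m4 m6 m8
  have hi : ∀ k, HasMoments (fun x : ℝ => x ^ k) (gaussianReal 0 1) :=
    fun k => (hasMoments_id_gaussianReal.pow k)
  have hc : ∀ a k, HasMoments (fun x : ℝ => a * x ^ k) (gaussianReal 0 1) :=
    fun a k => (hi k).const_mul a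
  have h1 : HasMoments (fun _ : ℝ => (1 : ℝ)) (gaussianReal 0 1) := hasMoments_const 1
  refine ⟨?_, ?_, ?_, ?_⟩
  · rw [HasMoments.integral_sub (hi 2) h1, m2]; simp
  · simp_rw [show ∀ x : ℝ, (x ^ 2 - 1) ^ 2 = x ^ 4 - 2 * x ^ 2 + 1 by intro x; ring]
    rw [HasMoments.integral_add ((hi 4).sub (hc 2 2)) h1,
      HasMoments.integral_sub (hi 4) (hc 2 2), integral_const_mul, m2, m4]
    norm_num
  · simp_rw [show ∀ x : ℝ, (x ^ 2 - 1) ^ 3 = x ^ 6 - 3 * x ^ 4 + 3 * x ^ 2 - 1 by intro x; ring]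
    rw [HasMoments.integral_sub (((hi 6).sub (hc 3 4)).add (hc 3 2)) h1,
      HasMoments.integral_add ((hi 6).sub (hc 3 4)) (hc 3 2), HasMoments.integral_sub (hi 6) (hc 3 4),
      integral_const_mul, integral_const_mul, m2, m4, m6]
    norm_num
  · simp_rw [show ∀ x : ℝ, (x ^ 2 - 1) ^ 4 = x ^ 8 - 4 * x ^ 6 + 6 * x ^ 4 - 4 * x ^ 2 + 1 by
      intro x; ring]
    rw [HasMoments.integral_add ((((hi 8).sub (hc 4 6)).add (hc 6 4)).sub (hc 4 2)) h1,
      HasMoments.integral_sub (((hi 8).sub (hc 4 6)).add (hc 6 4)) (hc 4 2),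
      HasMoments.integral_add ((hi 8).sub (hc 4 6)) (hc 6 4), HasMoments.integral_sub (hi 8) (hc 4 6),
      integral_const_mul, integral_const_mul, integral_const_mul, m2, m4, m6, m8]
    norm_num

/-- The first four moments of the centred chi-squared variable, by induction on the number of
independent squares in it. -/
theorem integral_chiSqCentred_pow (s : Finset ι) :
    ∫ x, chiSqCentred s x ∂(Measure.pi fun _ : ι => gaussianReal 0 1) = 0 ∧
    ∫ x, chiSqCentred s x ^ 2 ∂(Measure.pi fun _ : ι => gaussianReal 0 1) = 2 * s.card ∧
    ∫ x, chiSqCentred s x ^ 3 ∂(Measure.pi fun _ : ι => gaussianReal 0 1) = 8 * s.card ∧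
    ∫ x, chiSqCentred s x ^ 4 ∂(Measure.pi fun _ : ι => gaussianReal 0 1)
      = 12 * s.card ^ 2 + 48 * s.card := by
  classical
  set μ := Measure.pi fun _ : ι => gaussianReal 0 1 with hμ
  induction s using Finset.induction_on with
  | empty => simp [chiSqCentred]
  | insert i s hi ih =>
    obtain ⟨w1, w2, w3, w4⟩ := ih
    obtain ⟨v1, v2, v3, v4⟩ := integral_sq_sub_one_pow
    set V : (ι → ℝ) → ℝ := fun x => x i ^ 2 - 1 with hV
    set W : (ι → ℝ) → ℝ := chiSqCentred s with hW
    have hWm : HasMoments W μ := hasMoments_chiSqCentred s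
    have hVm : HasMoments V μ := ((hasMoments_eval_pi i).pow 2).sub (hasMoments_const 1)
    have hind : IndepFun W V μ := by
      have h := iIndepFun_pi (μ := fun _ : ι => gaussianReal 0 1)
        (X := fun _ (x : ℝ) => x ^ 2 - 1) (fun i => by fun_prop)
      have h2 := h.indepFun_finsetSum_of_notMem (fun i => by fun_prop) hi
      convert h2 using 1
      ext x
      simp [hW, chiSqCentred]
    have hev : ∀ F : ℝ → ℝ, Continuous F → ∫ x : ι → ℝ, F (x i) ∂μ
        = ∫ x, F x ∂(gaussianReal 0 1) := by
      intro F hF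
      have h := (measurePreserving_eval (fun _ : ι => gaussianReal 0 1) i).map_eq
      rw [← h, integral_map (measurable_pi_apply i).aemeasurable hF.aestronglyMeasurable]
    have k1 : ∫ x, V x ∂μ = 0 := (hev (fun x => x ^ 2 - 1) (by fun_prop)).trans v1
    have k2 : ∫ x, V x ^ 2 ∂μ = 2 := (hev (fun x => (x ^ 2 - 1) ^ 2) (by fun_prop)).trans v2
    have k3 : ∫ x, V x ^ 3 ∂μ = 8 := (hev (fun x => (x ^ 2 - 1) ^ 3) (by fun_prop)).trans v3
    have k4 : ∫ x, V x ^ 4 ∂μ = 60 := (hev (fun x => (x ^ 2 - 1) ^ 4) (by fun_prop)).trans v4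
    have hprod : ∀ a b : ℕ, ∫ x, W x ^ a * V x ^ b ∂μ = (∫ x, W x ^ a ∂μ) * ∫ x, V x ^ b ∂μ := by
      intro a b
      exact IndepFun.integral_fun_mul_eq_mul_integral
        (hind.comp (φ := fun x => x ^ a) (ψ := fun x => x ^ b) (by fun_prop) (by fun_prop))
        (hWm.pow a).aestronglyMeasurable (hVm.pow b).aestronglyMeasurable
    have hint : ∀ k a b, HasMoments (fun x => k * (W x ^ a * V x ^ b)) μ :=
      fun k a b => (((hWm.pow a).mul (hVm.pow b)).const_mul k)
    have hcs : ∀ x, chiSqCentred (insert i s) x = W x + V x := by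
      intro x
      rw [chiSqCentred, Finset.sum_insert hi, add_comm]
      rfl
    simp_rw [hcs, Finset.card_insert_of_notMem hi]
    have one : ∫ _, (1 : ℝ) ∂μ = 1 := by simp
    refine ⟨?_, ?_, ?_, ?_⟩
    · rw [HasMoments.integral_add hWm hVm, w1, k1, add_zero]
    · simp_rw [show ∀ x, (W x + V x) ^ 2 = 1 * (W x ^ 2 * V x ^ 0) + 2 * (W x ^ 1 * V x ^ 1)
        + 1 * (W x ^ 0 * V x ^ 2) by intro x; ring]
      rw [HasMoments.integral_add ((hint _ _ _).add (hint _ _ _)) (hint _ _ _),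
        HasMoments.integral_add (hint _ _ _) (hint _ _ _)]
      simp only [integral_const_mul, hprod]
      simp only [pow_zero, pow_one, one, w1, w2, k1, k2]
      push_cast; ring
    · simp_rw [show ∀ x, (W x + V x) ^ 3 = 1 * (W x ^ 3 * V x ^ 0) + 3 * (W x ^ 2 * V x ^ 1)
        + 3 * (W x ^ 1 * V x ^ 2) + 1 * (W x ^ 0 * V x ^ 3) by intro x; ring]
      rw [HasMoments.integral_add (((hint _ _ _).add (hint _ _ _)).add (hint _ _ _)) (hint _ _ _),
        HasMoments.integral_add ((hint _ _ _).add (hint _ _ _)) (hint _ _ _),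
        HasMoments.integral_add (hint _ _ _) (hint _ _ _)]
      simp only [integral_const_mul, hprod]
      simp only [pow_zero, pow_one, one, w1, w2, w3, k1, k2, k3]
      push_cast; ring
    · simp_rw [show ∀ x, (W x + V x) ^ 4 = 1 * (W x ^ 4 * V x ^ 0) + 4 * (W x ^ 3 * V x ^ 1)
        + 6 * (W x ^ 2 * V x ^ 2) + 4 * (W x ^ 1 * V x ^ 3) + 1 * (W x ^ 0 * V x ^ 4) by
          intro x; ring]
      rw [HasMoments.integral_add ((((hint _ _ _).add (hint _ _ _)).add (hint _ _ _)).add (hint _ _ _))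
          (hint _ _ _),
        HasMoments.integral_add (((hint _ _ _).add (hint _ _ _)).add (hint _ _ _)) (hint _ _ _),
        HasMoments.integral_add ((hint _ _ _).add (hint _ _ _)) (hint _ _ _),
        HasMoments.integral_add (hint _ _ _) (hint _ _ _)]
      simp only [integral_const_mul, hprod]
      simp only [pow_zero, pow_one, one, w1, w2, w3, w4, k1, k2, k3, k4]
      push_cast; ring

end ChiSq

open InnerProductSpace

/-! ### The Gram-Schmidt process: equivariance and dependence on the columns -/

section GramSchmidt

variable {n : ℕ}

/-- The vector `y` projected to the span of the Gram-Schmidt vectors of index less than `j`. -/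
noncomputable def prevProj (c : Fin n → EuclideanSpace ℝ (Fin n)) (j : Fin n)
    (y : EuclideanSpace ℝ (Fin n)) : EuclideanSpace ℝ (Fin n) :=
  ∑ i ∈ Finset.Iio j, ⟪gramSchmidtNormed ℝ c i, y⟫ • gramSchmidtNormed ℝ c i

variable (c : Fin n → EuclideanSpace ℝ (Fin n))

theorem gramSchmidt_eq_sub_prevProj (j : Fin n) :
    gramSchmidt ℝ c j = c j - prevProj c j (c j) := by
  rw [eq_sub_iff_add_eq]
  conv_rhs => rw [gramSchmidt_def'' ℝ c j]
  congr 1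
  refine Finset.sum_congr rfl fun i _ => ?_
  rw [gramSchmidtNormed, real_inner_smul_left, smul_smul]
  congr 1
  simp only [RCLike.ofReal_real_eq_id, id_eq]
  rw [div_eq_mul_inv, sq, mul_inv]
  ring

theorem norm_smul_gramSchmidtNormed (j : Fin n) :
    ‖gramSchmidt ℝ c j‖ • gramSchmidtNormed ℝ c j = gramSchmidt ℝ c j := by
  by_cases h : gramSchmidt ℝ c j = 0
  · simp [h]
  · rw [gramSchmidtNormed]
    exact smul_inv_smul₀ (norm_ne_zero_iff.2 h) _

theorem gramSchmidt_congr {c d : Fin n → EuclideanSpace ℝ (Fin n)} (j : Fin n)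
    (h : ∀ i ≤ j, c i = d i) : gramSchmidt ℝ c j = gramSchmidt ℝ d j := by
  induction j using WellFoundedLT.induction with
  | ind j ih =>
    rw [gramSchmidt_def, gramSchmidt_def, h j le_rfl]
    congr 1
    refine Finset.sum_congr rfl fun i hi => ?_
    have hij := Finset.mem_Iio.1 hi
    rw [ih i hij fun k hk => h k (hk.trans hij.le)]

theorem gramSchmidtNormed_congr {c d : Fin n → EuclideanSpace ℝ (Fin n)} (j : Fin n)
    (h : ∀ i ≤ j, c i = d i) : gramSchmidtNormed ℝ c j = gramSchmidtNormed ℝ d j := by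
  rw [gramSchmidtNormed, gramSchmidtNormed, gramSchmidt_congr j h]

theorem gramSchmidtNormed_update {i j : Fin n} (hij : i < j) (y : EuclideanSpace ℝ (Fin n)) :
    gramSchmidtNormed ℝ (Function.update c j y) i = gramSchmidtNormed ℝ c i :=
  gramSchmidtNormed_congr i fun _ hk => Function.update_of_ne (hk.trans_lt hij).ne _ _

theorem prevProj_update {i j : Fin n} (hij : i ≤ j) (y : EuclideanSpace ℝ (Fin n)) :
    prevProj (Function.update c j y) i = prevProj c i := by
  ext1 z
  refine Finset.sum_congr rfl fun k hk => ?_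
  rw [gramSchmidtNormed_update c ((Finset.mem_Iio.1 hk).trans_le hij)]

theorem gramSchmidt_map (L : EuclideanSpace ℝ (Fin n) ≃ₗᵢ[ℝ] EuclideanSpace ℝ (Fin n))
    (j : Fin n) : gramSchmidt ℝ (fun i => L (c i)) j = L (gramSchmidt ℝ c j) := by
  induction j using WellFoundedLT.induction with
  | ind j ih =>
    rw [gramSchmidt_def, gramSchmidt_def, map_sub, map_sum]
    congr 1
    refine Finset.sum_congr rfl fun i hi => ?_
    rw [ih i (Finset.mem_Iio.1 hi), Submodule.starProjection_singleton,
      Submodule.starProjection_singleton, map_smul, L.inner_map_map, L.norm_map]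

theorem gramSchmidtNormed_map (L : EuclideanSpace ℝ (Fin n) ≃ₗᵢ[ℝ] EuclideanSpace ℝ (Fin n))
    (j : Fin n) : gramSchmidtNormed ℝ (fun i => L (c i)) j = L (gramSchmidtNormed ℝ c j) := by
  rw [gramSchmidtNormed, gramSchmidtNormed, gramSchmidt_map, map_smul, L.norm_map]

theorem measurable_gramSchmidt (j : Fin n) :
    Measurable fun c : Fin n → EuclideanSpace ℝ (Fin n) => gramSchmidt ℝ c j := by
  induction j using WellFoundedLT.induction with
  | ind j ih =>
    have e : (fun c : Fin n → EuclideanSpace ℝ (Fin n) => gramSchmidt ℝ c j) = fun c =>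
        c j - ∑ i ∈ Finset.Iio j,
          (⟪gramSchmidt ℝ c i, c j⟫ / ‖gramSchmidt ℝ c i‖ ^ 2) • gramSchmidt ℝ c i := by
      funext c
      rw [eq_sub_iff_add_eq]
      exact (gramSchmidt_def'' ℝ c j).symm
    rw [e]
    refine (measurable_pi_apply j).sub (Finset.measurable_sum _ fun i hi => ?_)
    have := ih i (Finset.mem_Iio.1 hi)
    have h2 := measurable_pi_apply (X := fun _ => EuclideanSpace ℝ (Fin n)) j
    exact ((this.inner h2).div (this.norm.pow_const 2)).smul this

theorem measurable_gramSchmidtNormed (j : Fin n) :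
    Measurable fun c : Fin n → EuclideanSpace ℝ (Fin n) => gramSchmidtNormed ℝ c j := by
  simp_rw [gramSchmidtNormed]
  simp only [RCLike.ofReal_real_eq_id, id_eq]
  exact (measurable_gramSchmidt j).norm.inv.smul (measurable_gramSchmidt j)

/-- The Gram-Schmidt process runs without meeting the zero vector. -/
def NonDegenerate (c : Fin n → EuclideanSpace ℝ (Fin n)) : Prop := ∀ j, gramSchmidt ℝ c j ≠ 0

variable {c}

/-- An orthonormal basis that extends the nonzero Gram-Schmidt vectors. It exists for degenerate
columns as well, which allows the proof that degeneracy has probability zero to use it. -/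
theorem exists_orthonormalBasis_gramSchmidtNormed :
    ∃ b : OrthonormalBasis (Fin n) ℝ (EuclideanSpace ℝ (Fin n)),
      ∀ i, gramSchmidt ℝ c i ≠ 0 → gramSchmidtNormed ℝ c i = b i := by
  refine ⟨gramSchmidtOrthonormalBasis (by simp) c, fun i hi =>
    (gramSchmidtOrthonormalBasis_apply _ ?_).symm⟩
  rw [gramSchmidtNormed]
  exact smul_ne_zero (by simpa using hi) hi

theorem NonDegenerate.exists_basis (h : NonDegenerate c) :
    ∃ b : OrthonormalBasis (Fin n) ℝ (EuclideanSpace ℝ (Fin n)),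
      ∀ i, gramSchmidtNormed ℝ c i = b i := by
  obtain ⟨b, hb⟩ := exists_orthonormalBasis_gramSchmidtNormed (c := c)
  exact ⟨b, fun i => hb i (h i)⟩

end GramSchmidt

/-! ### Gaussian columns -/

section Columns

/-- The law of `n` independent standard Gaussian vectors in dimension `n`. -/
noncomputable def columnLaw (n : ℕ) : Measure (Fin n → EuclideanSpace ℝ (Fin n)) :=
  Measure.pi fun _ => stdGaussian (EuclideanSpace ℝ (Fin n))

instance (n : ℕ) : IsProbabilityMeasure (columnLaw n) := by
  unfold columnLaw; infer_instance

variable {n : ℕ}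

/-- Resampling one column does not change the law of the columns. This is the form in which the
independence of a column from the preceding ones is used. -/
theorem measurePreserving_update (j : Fin n) :
    MeasurePreserving
      (fun z : (Fin n → EuclideanSpace ℝ (Fin n)) × EuclideanSpace ℝ (Fin n) =>
        Function.update z.1 j z.2)
      ((columnLaw n).prod (stdGaussian (EuclideanSpace ℝ (Fin n)))) (columnLaw n) := by
  have hm : Measurable (fun z : (Fin n → EuclideanSpace ℝ (Fin n)) × EuclideanSpace ℝ (Fin n) =>
        Function.update z.1 j z.2) := by
    refine measurable_pi_iff.2 fun i => ?_
    by_cases h : i = j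
    · subst h
      simpa using measurable_snd
    · simp only [Function.update_of_ne h]
      exact (measurable_pi_apply i).comp measurable_fst
  refine ⟨hm, (Measure.pi_eq fun s hs => ?_).symm⟩
  rw [Measure.map_apply hm (MeasurableSet.univ_pi hs)]
  have e : (fun z : (Fin n → EuclideanSpace ℝ (Fin n)) × EuclideanSpace ℝ (Fin n) =>
        Function.update z.1 j z.2) ⁻¹' Set.univ.pi s
      = (Set.univ.pi (Function.update s j Set.univ)) ×ˢ s j := by
    ext ⟨c, y⟩
    simp only [Set.mem_preimage, Set.mem_pi, Set.mem_univ, true_implies, Set.mem_prod]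
    constructor
    · intro h
      refine ⟨fun i => ?_, by simpa using h j⟩
      by_cases hi : i = j
      · subst hi; simp
      · simpa [Function.update_of_ne hi] using h i
    · rintro ⟨h1, h2⟩ i
      by_cases hi : i = j
      · subst hi; simpa using h2
      · simpa [Function.update_of_ne hi] using h1 i
  rw [e, Measure.prod_prod, columnLaw, Measure.pi_pi,
    ← Finset.mul_prod_erase _ _ (Finset.mem_univ j),
    ← Finset.mul_prod_erase _ (fun i => stdGaussian _ (s i)) (Finset.mem_univ j)]
  simp only [Function.update_self, measure_univ, one_mul]
  rw [mul_comm]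
  congr 1
  refine Finset.prod_congr rfl fun i hi => ?_
  rw [Function.update_of_ne (Finset.ne_of_mem_erase hi)]

/-- The law of the columns is invariant under a common rotation. -/
theorem measurePreserving_rotate
    (L : EuclideanSpace ℝ (Fin n) ≃ₗᵢ[ℝ] EuclideanSpace ℝ (Fin n)) :
    MeasurePreserving (fun (c : Fin n → EuclideanSpace ℝ (Fin n)) i => L (c i))
      (columnLaw n) (columnLaw n) := by
  have h : MeasurePreserving L (stdGaussian (EuclideanSpace ℝ (Fin n)))
      (stdGaussian (EuclideanSpace ℝ (Fin n))) := ⟨L.continuous.measurable, stdGaussian_map L⟩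
  exact measurePreserving_pi _ _ fun _ => h

theorem stdGaussian_hyperplane {u : EuclideanSpace ℝ (Fin n)} (hu : ‖u‖ = 1) :
    stdGaussian (EuclideanSpace ℝ (Fin n)) {y | ⟪u, y⟫ = 0} = 0 := by
  have h := congrArg (fun m => m {0}) (map_inner_stdGaussian u)
  simp only [hu, one_mul, Measure.map_id'] at h
  have := nullSingletonClass_gaussianReal (μ := 0) (v := 1) one_ne_zero
  rw [Measure.map_apply (by fun_prop) (measurableSet_singleton 0)] at h
  exact h.trans (measure_singleton 0)

/-- Given the preceding columns, the `j`-th one almost surely avoids the hyperplane orthogonal to a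
unit vector that is orthogonal to all of the preceding Gram-Schmidt vectors. -/
theorem ae_nonDegenerate : ∀ᵐ c ∂(columnLaw n), NonDegenerate c := by
  unfold NonDegenerate
  rw [ae_all_iff]
  intro j
  have hms : MeasurableSet {c : Fin n → EuclideanSpace ℝ (Fin n) | gramSchmidt ℝ c j ≠ 0} :=
    (measurable_gramSchmidt j (measurableSet_singleton 0)).compl
  rw [← (measurePreserving_update j).map_eq]
  rw [ae_map_iff (measurePreserving_update j).measurable.aemeasurable hms]
  refine (Measure.ae_prod_iff_ae_ae ((measurePreserving_update j).measurable hms)).2 ?_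
  refine Eventually.of_forall fun c => ?_
  obtain ⟨b, hb⟩ := exists_orthonormalBasis_gramSchmidtNormed (c := c)
  have h0 := stdGaussian_hyperplane (b.norm_eq_one j)
  rw [← compl_mem_ae_iff] at h0
  filter_upwards [h0] with y hy hw
  refine hy ?_
  rw [gramSchmidt_eq_sub_prevProj, prevProj_update c le_rfl, Function.update_self,
    sub_eq_zero] at hw
  change ⟪b j, y⟫ = 0
  rw [hw, prevProj, inner_sum]
  refine Finset.sum_eq_zero fun i hi => ?_
  rw [inner_smul_right]
  by_cases hc : gramSchmidt ℝ c i = 0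
  · simp [gramSchmidtNormed, hc]
  · rw [hb i hc, b.inner_eq_zero (Finset.mem_Iio.1 hi).ne', mul_zero]

/-- Conditioning on all columns but one. The inner integral is needed only for nondegenerate `c`. -/
theorem integral_columnLaw_eq (j : Fin n) {F : (Fin n → EuclideanSpace ℝ (Fin n)) → ℝ}
    {G : (Fin n → EuclideanSpace ℝ (Fin n)) → ℝ} (hF : Integrable F (columnLaw n))
    (h : ∀ c, NonDegenerate c →
      ∫ y, F (Function.update c j y) ∂(stdGaussian (EuclideanSpace ℝ (Fin n))) = G c) :
    ∫ c, F c ∂(columnLaw n) = ∫ c, G c ∂(columnLaw n) := by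
  have hp := measurePreserving_update j
  have hF' : AEStronglyMeasurable F (((columnLaw n).prod
      (stdGaussian (EuclideanSpace ℝ (Fin n)))).map fun z => Function.update z.1 j z.2) := by
    rw [hp.map_eq]; exact hF.aestronglyMeasurable
  have h1 := integral_map hp.measurable.aemeasurable hF'
  rw [hp.map_eq] at h1
  rw [h1]
  refine (integral_prod _ (hp.integrable_comp_of_integrable hF)).trans ?_
  refine integral_congr_ae ?_
  filter_upwards [ae_nonDegenerate] with c hc
  exact h c hc

end Columns

/-! ### Moments of the Gram-Schmidt vectors -/

section Moments

variable {n : ℕ}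

theorem norm_gramSchmidtNormed_le (c : Fin n → EuclideanSpace ℝ (Fin n)) (j : Fin n) :
    ‖gramSchmidtNormed ℝ c j‖ ≤ 1 := by
  by_cases h : gramSchmidtNormed ℝ c j = 0
  · simp [h]
  · exact (gramSchmidtNormed_unit_length' h).le

theorem hasMoments_inner_column (j : Fin n) (u : EuclideanSpace ℝ (Fin n)) :
    HasMoments (fun c : Fin n → EuclideanSpace ℝ (Fin n) => ⟪u, c j⟫) (columnLaw n) :=
  (hasMoments_inner_stdGaussian u).comp (measurePreserving_eval _ j)

theorem hasMoments_norm_sq_of_inner {α : Type*} {_ : MeasurableSpace α} {μ : Measure α}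
    [IsFiniteMeasure μ] {f : α → EuclideanSpace ℝ (Fin n)}
    (h : ∀ a, HasMoments (fun x => f x a) μ) : HasMoments (fun x => ‖f x‖ ^ 2) μ := by
  simp_rw [EuclideanSpace.real_norm_sq_eq]
  exact HasMoments.sum _ fun a _ => (h a).pow 2

theorem hasMoments_of_sq {α : Type*} {_ : MeasurableSpace α} {μ : Measure α}
    [IsFiniteMeasure μ] {f g : α → ℝ} (hg : HasMoments (fun x => g x ^ 2) μ)
    (hf : AEStronglyMeasurable f μ) (h : ∀ x, |f x| ≤ |g x|) : HasMoments f μ := by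
  refine ((hasMoments_const 1).add hg).mono hf (Eventually.of_forall fun x => ?_)
  refine (h x).trans ?_
  rw [← sq_abs (g x)]
  nlinarith [sq_nonneg (|g x| - 1), abs_nonneg (g x)]

theorem hasMoments_norm_column_sq (j : Fin n) :
    HasMoments (fun c : Fin n → EuclideanSpace ℝ (Fin n) => ‖c j‖ ^ 2) (columnLaw n) := by
  refine hasMoments_norm_sq_of_inner fun a => ?_
  simpa [EuclideanSpace.inner_single_left] using
    hasMoments_inner_column j (EuclideanSpace.single a (1 : ℝ))

theorem hasMoments_inner_gramSchmidtNormed (i : Fin n) (u : EuclideanSpace ℝ (Fin n)) :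
    HasMoments (fun c : Fin n → EuclideanSpace ℝ (Fin n) => ⟪gramSchmidtNormed ℝ c i, u⟫)
      (columnLaw n) := by
  refine (hasMoments_const ‖u‖).mono
    ((measurable_gramSchmidtNormed i).inner measurable_const).aestronglyMeasurable
    (Eventually.of_forall fun c => ?_)
  refine (abs_real_inner_le_norm _ _).trans ?_
  exact mul_le_of_le_one_left (norm_nonneg _) (norm_gramSchmidtNormed_le c i)

theorem hasMoments_inner_gramSchmidtNormed_column (i j : Fin n) :
    HasMoments (fun c : Fin n → EuclideanSpace ℝ (Fin n) => ⟪gramSchmidtNormed ℝ c i, c j⟫)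
      (columnLaw n) := by
  refine hasMoments_of_sq (hasMoments_norm_column_sq j)
    ((measurable_gramSchmidtNormed i).inner (measurable_pi_apply j)).aestronglyMeasurable
    fun c => ?_
  refine (abs_real_inner_le_norm _ _).trans ?_
  rw [abs_norm]
  exact mul_le_of_le_one_left (norm_nonneg _) (norm_gramSchmidtNormed_le c i)

theorem hasMoments_gramSchmidtNormed_apply (i a : Fin n) :
    HasMoments (fun c : Fin n → EuclideanSpace ℝ (Fin n) => gramSchmidtNormed ℝ c i a)
      (columnLaw n) := by
  simpa [EuclideanSpace.inner_single_right] using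
    hasMoments_inner_gramSchmidtNormed i (EuclideanSpace.single a (1 : ℝ))

theorem hasMoments_prevProj_apply (j a : Fin n) :
    HasMoments (fun c : Fin n → EuclideanSpace ℝ (Fin n) => prevProj c j (c j) a)
      (columnLaw n) := by
  simp only [prevProj, WithLp.ofLp_sum, WithLp.ofLp_smul, Finset.sum_apply, Pi.smul_apply,
    smul_eq_mul]
  exact HasMoments.sum _ fun i _ => (hasMoments_inner_gramSchmidtNormed_column i j).mul
    (hasMoments_gramSchmidtNormed_apply i a)

theorem hasMoments_norm_gramSchmidt (j : Fin n) :
    HasMoments (fun c : Fin n → EuclideanSpace ℝ (Fin n) => ‖gramSchmidt ℝ c j‖)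
      (columnLaw n) := by
  refine hasMoments_of_sq (g := fun c => ‖gramSchmidt ℝ c j‖) ?_
    (measurable_gramSchmidt j).norm.aestronglyMeasurable fun c => le_rfl
  refine hasMoments_norm_sq_of_inner fun a => ?_
  simp_rw [gramSchmidt_eq_sub_prevProj, PiLp.sub_apply]
  refine HasMoments.sub ?_ (hasMoments_prevProj_apply j a)
  simpa [EuclideanSpace.inner_single_left] using
    hasMoments_inner_column j (EuclideanSpace.single a (1 : ℝ))

end Moments

/-! ### Consequences of rotation invariance -/

section Rotation

variable {n : ℕ}

/-- The bilinear form of the projection to the span of the Gram-Schmidt vectors with index in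
`s`. -/
noncomputable def gramForm (s : Finset (Fin n)) (c : Fin n → EuclideanSpace ℝ (Fin n))
    (u v : EuclideanSpace ℝ (Fin n)) : ℝ :=
  ∑ i ∈ s, ⟪gramSchmidtNormed ℝ c i, u⟫ * ⟪gramSchmidtNormed ℝ c i, v⟫

variable (s : Finset (Fin n)) (c : Fin n → EuclideanSpace ℝ (Fin n))

theorem gramForm_map (L : EuclideanSpace ℝ (Fin n) ≃ₗᵢ[ℝ] EuclideanSpace ℝ (Fin n))
    (u v : EuclideanSpace ℝ (Fin n)) :
    gramForm s (fun i => L (c i)) (L u) (L v) = gramForm s c u v := by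
  simp only [gramForm, gramSchmidtNormed_map, L.inner_map_map]

theorem gramForm_comm (u v : EuclideanSpace ℝ (Fin n)) :
    gramForm s c u v = gramForm s c v u := by
  simp only [gramForm, mul_comm]

theorem gramForm_add_left (u v w : EuclideanSpace ℝ (Fin n)) :
    gramForm s c (u + v) w = gramForm s c u w + gramForm s c v w := by
  simp only [gramForm, inner_add_right, add_mul, Finset.sum_add_distrib]

theorem gramForm_smul_left (r : ℝ) (u w : EuclideanSpace ℝ (Fin n)) :
    gramForm s c (r • u) w = r * gramForm s c u w := by
  simp only [gramForm, inner_smul_right, Finset.mul_sum, mul_assoc]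

theorem gramForm_sub_left (u v w : EuclideanSpace ℝ (Fin n)) :
    gramForm s c (u - v) w = gramForm s c u w - gramForm s c v w := by
  simp only [gramForm, inner_sub_right, sub_mul, Finset.sum_sub_distrib]

theorem hasMoments_gramForm (u v : EuclideanSpace ℝ (Fin n)) :
    HasMoments (fun c => gramForm s c u v) (columnLaw n) :=
  HasMoments.sum s fun i _ =>
    (hasMoments_inner_gramSchmidtNormed i u).mul (hasMoments_inner_gramSchmidtNormed i v)

/-- The entries, in the standard basis, of the projection to the span of the Gram-Schmidt vectors
with index in `s`. -/
noncomputable def gramEntry (s : Finset (Fin n)) (c : Fin n → EuclideanSpace ℝ (Fin n))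
    (a b : Fin n) : ℝ :=
  gramForm s c (EuclideanSpace.single a 1) (EuclideanSpace.single b 1)

theorem gramEntry_eq (a b : Fin n) :
    gramEntry s c a b = ∑ i ∈ s, gramSchmidtNormed ℝ c i a * gramSchmidtNormed ℝ c i b := by
  simp [gramEntry, gramForm, EuclideanSpace.inner_single_right]

theorem hasMoments_gramEntry (a b : Fin n) :
    HasMoments (fun c => gramEntry s c a b) (columnLaw n) := hasMoments_gramForm s _ _

variable {c}

theorem NonDegenerate.orthonormal (hc : NonDegenerate c) :
    Orthonormal ℝ (gramSchmidtNormed ℝ c) := by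
  obtain ⟨b, hb⟩ := hc.exists_basis
  rw [funext hb]
  exact b.orthonormal

/-- The trace of a projection is its rank. -/
theorem sum_gramEntry_self (hc : NonDegenerate c) : ∑ a, gramEntry s c a a = s.card := by
  simp_rw [gramEntry_eq]
  rw [Finset.sum_comm]
  have : ∀ i ∈ s, ∑ a, gramSchmidtNormed ℝ c i a * gramSchmidtNormed ℝ c i a = 1 := by
    intro i _
    have h := hc.orthonormal.1 i
    have h2 := EuclideanSpace.real_norm_sq_eq (gramSchmidtNormed ℝ c i)
    rw [h] at h2
    simpa [sq] using h2.symm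
  rw [Finset.sum_congr rfl this]
  simp

/-- The squared Hilbert-Schmidt norm of a projection is its rank. -/
theorem sum_gramEntry_sq (hc : NonDegenerate c) : ∑ a, ∑ b, gramEntry s c a b ^ 2 = s.card := by
  have horth : ∀ i k, ∑ a, gramSchmidtNormed ℝ c i a * gramSchmidtNormed ℝ c k a
      = if i = k then 1 else 0 := by
    intro i k
    have h := orthonormal_iff_ite.1 hc.orthonormal i k
    rw [← h, PiLp.inner_apply]
    simp [mul_comm]
  have e : ∀ a b, gramEntry s c a b ^ 2 = ∑ i ∈ s, ∑ k ∈ s,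
      (gramSchmidtNormed ℝ c i a * gramSchmidtNormed ℝ c k a) *
      (gramSchmidtNormed ℝ c i b * gramSchmidtNormed ℝ c k b) := by
    intro a b
    rw [gramEntry_eq, sq, Finset.sum_mul_sum]
    refine Finset.sum_congr rfl fun i _ => Finset.sum_congr rfl fun k _ => by ring
  simp_rw [e]
  calc ∑ a, ∑ b, ∑ i ∈ s, ∑ k ∈ s,
      (gramSchmidtNormed ℝ c i a * gramSchmidtNormed ℝ c k a) *
      (gramSchmidtNormed ℝ c i b * gramSchmidtNormed ℝ c k b)
      = ∑ i ∈ s, ∑ k ∈ s, (∑ a, gramSchmidtNormed ℝ c i a * gramSchmidtNormed ℝ c k a) *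
        (∑ b, gramSchmidtNormed ℝ c i b * gramSchmidtNormed ℝ c k b) := by
        simp_rw [Finset.sum_mul_sum]
        have h1 : ∀ a, ∑ b, ∑ i ∈ s, ∑ k ∈ s,
            (gramSchmidtNormed ℝ c i a * gramSchmidtNormed ℝ c k a) *
            (gramSchmidtNormed ℝ c i b * gramSchmidtNormed ℝ c k b)
            = ∑ i ∈ s, ∑ k ∈ s, ∑ b, (gramSchmidtNormed ℝ c i a * gramSchmidtNormed ℝ c k a) *
            (gramSchmidtNormed ℝ c i b * gramSchmidtNormed ℝ c k b) := by
          intro a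
          rw [Finset.sum_comm]
          exact Finset.sum_congr rfl fun i _ => Finset.sum_comm
        simp_rw [h1]
        rw [Finset.sum_comm]
        exact Finset.sum_congr rfl fun i _ => Finset.sum_comm
    _ = s.card := by simp [horth]

theorem integral_rotate {F : (Fin n → EuclideanSpace ℝ (Fin n)) → ℝ}
    (hF : HasMoments F (columnLaw n))
    (L : EuclideanSpace ℝ (Fin n) ≃ₗᵢ[ℝ] EuclideanSpace ℝ (Fin n)) :
    ∫ c, F (fun i => L (c i)) ∂(columnLaw n) = ∫ c, F c ∂(columnLaw n) := by
  have h := measurePreserving_rotate (n := n) L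
  have hF' : AEStronglyMeasurable F ((columnLaw n).map fun c i => L (c i)) := by
    rw [h.map_eq]; exact hF.aestronglyMeasurable
  have h1 := integral_map h.measurable.aemeasurable hF'
  rw [h.map_eq] at h1
  exact h1.symm

theorem integral_gramForm_map {φ : (Fin n → EuclideanSpace ℝ (Fin n)) → ℝ}
    (hφ : HasMoments φ (columnLaw n))
    (hinv : ∀ (L : EuclideanSpace ℝ (Fin n) ≃ₗᵢ[ℝ] EuclideanSpace ℝ (Fin n)) c,
      φ (fun i => L (c i)) = φ c)
    (L : EuclideanSpace ℝ (Fin n) ≃ₗᵢ[ℝ] EuclideanSpace ℝ (Fin n))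
    (u v : EuclideanSpace ℝ (Fin n)) (x y : EuclideanSpace ℝ (Fin n)) :
    ∫ c, φ c * (gramForm s c (L u) (L v) * gramForm s c (L x) (L y)) ∂(columnLaw n)
      = ∫ c, φ c * (gramForm s c u v * gramForm s c x y) ∂(columnLaw n) := by
  rw [← integral_rotate (hφ.mul ((hasMoments_gramForm s _ _).mul (hasMoments_gramForm s _ _))) L]
  simp_rw [hinv, gramForm_map]

end Rotation

/-! ### Second moments of the entries of projections -/

section SecondMoments

variable {n : ℕ}

theorem exists_isometry_of_norm_eq {u v : EuclideanSpace ℝ (Fin n)} (h : ‖u‖ = ‖v‖) :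
    ∃ L : EuclideanSpace ℝ (Fin n) ≃ₗᵢ[ℝ] EuclideanSpace ℝ (Fin n), L u = v :=
  ⟨_, Submodule.reflection_sub h⟩

theorem exists_isometry_single_pair {a b a' b' : Fin n} (hab : a ≠ b) (hab' : a' ≠ b') :
    ∃ L : EuclideanSpace ℝ (Fin n) ≃ₗᵢ[ℝ] EuclideanSpace ℝ (Fin n),
      L (EuclideanSpace.single a 1) = EuclideanSpace.single a' 1 ∧
      L (EuclideanSpace.single b 1) = EuclideanSpace.single b' 1 := by
  set τ := Equiv.swap a a' with hτ
  set σ := τ.trans (Equiv.swap (τ b) b') with hσ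
  have hb : τ b ≠ a' := by
    intro h
    have : τ a = a' := Equiv.swap_apply_left a a'
    exact hab (τ.injective (this.trans h.symm))
  have h1 : σ a = a' := by
    rw [hσ, Equiv.trans_apply, hτ, Equiv.swap_apply_left, ← hτ]
    exact Equiv.swap_apply_of_ne_of_ne hb.symm hab'
  have h2 : σ b = b' := by
    rw [hσ, Equiv.trans_apply, Equiv.swap_apply_left]
  refine ⟨LinearIsometryEquiv.piLpCongrLeft 2 ℝ ℝ σ, ?_, ?_⟩
  · rw [← h1]; exact LinearIsometryEquiv.piLpCongrLeft_single σ a 1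
  · rw [← h2]; exact LinearIsometryEquiv.piLpCongrLeft_single σ b 1

theorem sum_sum_eq_card {F : Fin n → Fin n → ℝ} {x y : ℝ} (T : Finset (Fin n))
    (hx : ∀ a, F a a = x) (hy : ∀ a b, a ≠ b → F a b = y) :
    ∑ a ∈ T, ∑ b ∈ T, F a b = T.card * x + T.card * (T.card - 1) * y := by
  have : ∀ a ∈ T, ∑ b ∈ T, F a b = x + (T.card - 1) * y := by
    intro a ha
    have hpos := Finset.card_pos.2 ⟨a, ha⟩
    rw [← Finset.add_sum_erase _ _ ha, hx a,
      Finset.sum_congr rfl fun b hb => hy a b (Finset.ne_of_mem_erase hb).symm,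
      Finset.sum_const, Finset.card_erase_of_mem ha, nsmul_eq_mul, Nat.cast_sub (by omega),
      Nat.cast_one]
  rw [Finset.sum_congr rfl this]
  simp only [Finset.sum_const, nsmul_eq_mul]
  ring

/-- For a rotation invariant weight `φ` and a set `s` of Gram-Schmidt vectors, the second moments
of the entries of the weighted projection matrix are determined by rotation invariance: `A`, `B`,
`C` are the moments of two diagonal entries, equal or distinct, and of an off-diagonal entry. The
relation `A = B + 2 * C` comes from a rotation by an eighth of a turn, and the other two come from
the trace and the Hilbert-Schmidt norm of a projection. -/
theorem exists_gramEntry_moments (hn : 2 ≤ n) {φ : (Fin n → EuclideanSpace ℝ (Fin n)) → ℝ}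
    (hφ : HasMoments φ (columnLaw n))
    (hinv : ∀ (L : EuclideanSpace ℝ (Fin n) ≃ₗᵢ[ℝ] EuclideanSpace ℝ (Fin n)) c,
      φ (fun i => L (c i)) = φ c) (s : Finset (Fin n)) :
    ∃ A B C : ℝ,
      (∀ a, ∫ c, φ c * (gramEntry s c a a * gramEntry s c a a) ∂(columnLaw n) = A) ∧
      (∀ a b, a ≠ b → ∫ c, φ c * (gramEntry s c a a * gramEntry s c b b) ∂(columnLaw n) = B) ∧
      (∀ a b, a ≠ b → ∫ c, φ c * (gramEntry s c a b * gramEntry s c a b) ∂(columnLaw n) = C) ∧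
      A = B + 2 * C ∧
      n * A + n * (n - 1) * B = s.card ^ 2 * ∫ c, φ c ∂(columnLaw n) ∧
      n * A + n * (n - 1) * C = s.card * ∫ c, φ c ∂(columnLaw n) := by
  set μ := columnLaw n with hμ
  let a₀ : Fin n := ⟨0, by omega⟩
  let b₀ : Fin n := ⟨1, by omega⟩
  have h01 : a₀ ≠ b₀ := by simp [a₀, b₀, Fin.ext_iff]
  have hint : ∀ u v x y : EuclideanSpace ℝ (Fin n),
      HasMoments (fun c => φ c * (gramForm s c u v * gramForm s c x y)) μ := fun u v x y =>
    hφ.mul ((hasMoments_gramForm s u v).mul (hasMoments_gramForm s x y))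
  -- all pairs of distinct coordinates are equivalent under permutations
  have hB : ∀ a b, a ≠ b → ∫ c, φ c * (gramEntry s c a a * gramEntry s c b b) ∂μ
      = ∫ c, φ c * (gramEntry s c a₀ a₀ * gramEntry s c b₀ b₀) ∂μ := by
    intro a b hab
    obtain ⟨L, h1, h2⟩ := exists_isometry_single_pair h01 hab
    simp only [gramEntry]
    rw [← h1, ← h2, hμ, integral_gramForm_map s hφ hinv]
  have hC : ∀ a b, a ≠ b → ∫ c, φ c * (gramEntry s c a b * gramEntry s c a b) ∂μ
      = ∫ c, φ c * (gramEntry s c a₀ b₀ * gramEntry s c a₀ b₀) ∂μ := by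
    intro a b hab
    obtain ⟨L, h1, h2⟩ := exists_isometry_single_pair h01 hab
    simp only [gramEntry]
    rw [← h1, ← h2, hμ, integral_gramForm_map s hφ hinv]
  -- the diagonal moment depends on the vector through its norm only
  have hnorm : ∀ (r : ℝ) (u : EuclideanSpace ℝ (Fin n)), ‖u‖ = |r| →
      ∫ c, φ c * (gramForm s c u u * gramForm s c u u) ∂μ
        = r ^ 4 * ∫ c, φ c * (gramEntry s c a₀ a₀ * gramEntry s c a₀ a₀) ∂μ := by
    intro r u hu
    have hn' : ‖u‖ = ‖r • EuclideanSpace.single a₀ (1 : ℝ)‖ := by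
      rw [hu, norm_smul]; simp
    obtain ⟨L, hL⟩ := exists_isometry_of_norm_eq hn'
    rw [hμ, ← integral_gramForm_map s hφ hinv L, hL, ← integral_const_mul]
    refine integral_congr_ae (Eventually.of_forall fun c => ?_)
    simp only [gramForm_smul_left, gramForm_comm s c _ (r • _), gramEntry]
    ring
  have hA : ∀ a, ∫ c, φ c * (gramEntry s c a a * gramEntry s c a a) ∂μ
      = ∫ c, φ c * (gramEntry s c a₀ a₀ * gramEntry s c a₀ a₀) ∂μ := by
    intro a
    simpa [gramEntry] using hnorm 1 (EuclideanSpace.single a 1) (by simp)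
  have hdiag : ∀ (F : Fin n → Fin n → ℝ) {x y : ℝ}, (∀ a, F a a = x) →
      (∀ a b, a ≠ b → F a b = y) → ∑ a, ∑ b, F a b = n * x + n * (n - 1) * y := by
    intro F x y hx hy
    simpa using sum_sum_eq_card Finset.univ hx hy
  refine ⟨_, _, _, hA, hB, hC, ?_, ?_, ?_⟩
  · set e₁ : EuclideanSpace ℝ (Fin n) := EuclideanSpace.single a₀ 1
    set e₂ : EuclideanSpace ℝ (Fin n) := EuclideanSpace.single b₀ 1
    have he : ⟪e₁, e₂⟫ = 0 := by
      simp [e₁, e₂, EuclideanSpace.inner_single_left, h01]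
    have n1 : ‖e₁‖ = 1 := by simp [e₁]
    have n2 : ‖e₂‖ = 1 := by simp [e₂]
    have np : ‖e₁ + e₂‖ = |√2| := by
      rw [abs_of_nonneg (Real.sqrt_nonneg 2), eq_comm, Real.sqrt_eq_iff_mul_self_eq (by norm_num)
        (norm_nonneg _), ← sq, norm_add_sq_real, he, n1, n2]
      norm_num
    have nm : ‖e₁ - e₂‖ = |√2| := by
      rw [abs_of_nonneg (Real.sqrt_nonneg 2), eq_comm, Real.sqrt_eq_iff_mul_self_eq (by norm_num)
        (norm_nonneg _), ← sq, norm_sub_sq_real, he, n1, n2]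
      norm_num
    have hp := hnorm _ _ np
    have hm := hnorm _ _ nm
    have h4 : √2 ^ 4 = 4 := by
      rw [show √2 ^ 4 = (√2 ^ 2) ^ 2 by ring, Real.sq_sqrt (by norm_num)]; norm_num
    rw [h4] at hp hm
    -- the sum of the two identities cancels the mixed terms of odd degree
    have hsum : ∫ c, φ c * (gramForm s c (e₁ + e₂) (e₁ + e₂) * gramForm s c (e₁ + e₂) (e₁ + e₂)) ∂μ
        + ∫ c, φ c * (gramForm s c (e₁ - e₂) (e₁ - e₂) * gramForm s c (e₁ - e₂) (e₁ - e₂)) ∂μ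
        = 2 * ∫ c, φ c * (gramForm s c e₁ e₁ * gramForm s c e₁ e₁) ∂μ
        + 2 * ∫ c, φ c * (gramForm s c e₂ e₂ * gramForm s c e₂ e₂) ∂μ
        + 4 * ∫ c, φ c * (gramForm s c e₁ e₁ * gramForm s c e₂ e₂) ∂μ
        + 8 * ∫ c, φ c * (gramForm s c e₁ e₂ * gramForm s c e₁ e₂) ∂μ := by
      rw [← (hint _ _ _ _).integral_add (hint _ _ _ _), ← integral_const_mul, ← integral_const_mul,
        ← integral_const_mul, ← integral_const_mul,
        ← ((hint _ _ _ _).const_mul 2).integral_add ((hint _ _ _ _).const_mul 2),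
        ← (((hint _ _ _ _).const_mul 2).add ((hint _ _ _ _).const_mul 2)).integral_add
          ((hint _ _ _ _).const_mul 4),
        ← ((((hint _ _ _ _).const_mul 2).add ((hint _ _ _ _).const_mul 2)).add
          ((hint _ _ _ _).const_mul 4)).integral_add ((hint _ _ _ _).const_mul 8)]
      refine integral_congr_ae (Eventually.of_forall fun c => ?_)
      simp only [gramForm_add_left, gramForm_sub_left, gramForm_comm s c _ (e₁ + e₂),
        gramForm_comm s c _ (e₁ - e₂), gramForm_comm s c e₂ e₁]
      ring
    have hA2 := hA b₀
    simp only [gramEntry] at hA2 hp hm ⊢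
    rw [hp, hm, hA2] at hsum
    linarith
  · rw [← hdiag (fun a b => ∫ c, φ c * (gramEntry s c a a * gramEntry s c b b) ∂μ) hA hB]
    rw [← integral_const_mul]
    have hi : ∀ a b, HasMoments (fun c => φ c * (gramEntry s c a a * gramEntry s c b b)) μ :=
      fun a b => hint _ _ _ _
    have e : ∀ a, ∑ b, ∫ c, φ c * (gramEntry s c a a * gramEntry s c b b) ∂μ
        = ∫ c, ∑ b, φ c * (gramEntry s c a a * gramEntry s c b b) ∂μ :=
      fun a => (HasMoments.integral_sum _ fun b _ => hi a b).symm
    simp_rw [e]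
    rw [← HasMoments.integral_sum _ fun a _ => HasMoments.sum _ fun b _ => hi a b]
    refine integral_congr_ae ?_
    filter_upwards [ae_nonDegenerate] with c hc
    rw [← sum_gramEntry_self s hc, sq, Finset.sum_mul_sum, Finset.sum_mul]
    refine Finset.sum_congr rfl fun a _ => ?_
    rw [Finset.sum_mul]
    exact Finset.sum_congr rfl fun b _ => by ring
  · rw [← hdiag (fun a b => ∫ c, φ c * (gramEntry s c a b * gramEntry s c a b) ∂μ) hA hC]
    rw [← integral_const_mul]
    have hi : ∀ a b, HasMoments (fun c => φ c * (gramEntry s c a b * gramEntry s c a b)) μ :=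
      fun a b => hint _ _ _ _
    have e : ∀ a, ∑ b, ∫ c, φ c * (gramEntry s c a b * gramEntry s c a b) ∂μ
        = ∫ c, ∑ b, φ c * (gramEntry s c a b * gramEntry s c a b) ∂μ :=
      fun a => (HasMoments.integral_sum _ fun b _ => hi a b).symm
    simp_rw [e]
    rw [← HasMoments.integral_sum _ fun a _ => HasMoments.sum _ fun b _ => hi a b]
    refine integral_congr_ae ?_
    filter_upwards [ae_nonDegenerate] with c hc
    rw [← sum_gramEntry_sq s hc, Finset.sum_mul]
    refine Finset.sum_congr rfl fun a _ => ?_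
    rw [Finset.sum_mul]
    exact Finset.sum_congr rfl fun b _ => by ring

/-- The sum of the diagonal entries of a projection over a set `T` of rows. For `s = {j}` it is the
squared length of the part of the `j`-th Gram-Schmidt vector in the rows `T`. -/
noncomputable def partialTrace (s T : Finset (Fin n)) (c : Fin n → EuclideanSpace ℝ (Fin n)) : ℝ :=
  ∑ a ∈ T, gramEntry s c a a

theorem hasMoments_partialTrace (s T : Finset (Fin n)) :
    HasMoments (partialTrace s T) (columnLaw n) :=
  HasMoments.sum _ fun _ _ => hasMoments_gramEntry _ _ _

theorem integral_mul_partialTrace (hn : 0 < n) {φ : (Fin n → EuclideanSpace ℝ (Fin n)) → ℝ}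
    (hφ : HasMoments φ (columnLaw n))
    (hinv : ∀ (L : EuclideanSpace ℝ (Fin n) ≃ₗᵢ[ℝ] EuclideanSpace ℝ (Fin n)) c,
      φ (fun i => L (c i)) = φ c) (s T : Finset (Fin n)) :
    ∫ c, φ c * partialTrace s T c ∂(columnLaw n)
      = T.card * s.card / n * ∫ c, φ c ∂(columnLaw n) := by
  set μ := columnLaw n with hμ
  let a₀ : Fin n := ⟨0, hn⟩
  have hi : ∀ a, HasMoments (fun c => φ c * gramEntry s c a a) μ :=
    fun a => hφ.mul (hasMoments_gramEntry s a a)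
  have hA : ∀ a, ∫ c, φ c * gramEntry s c a a ∂μ = ∫ c, φ c * gramEntry s c a₀ a₀ ∂μ := by
    intro a
    have hn' : ‖EuclideanSpace.single a (1 : ℝ)‖ = ‖EuclideanSpace.single a₀ (1 : ℝ)‖ := by simp
    obtain ⟨L, hL⟩ := exists_isometry_of_norm_eq hn'
    have h := integral_rotate (hi a₀) L
    rw [← h]
    refine integral_congr_ae (Eventually.of_forall fun c => ?_)
    simp only [gramEntry]
    rw [hinv, ← hL, gramForm_map]
  have hs : ∀ T : Finset (Fin n), ∫ c, φ c * partialTrace s T c ∂μ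
      = T.card * ∫ c, φ c * gramEntry s c a₀ a₀ ∂μ := by
    intro T
    simp_rw [partialTrace, Finset.mul_sum]
    rw [HasMoments.integral_sum _ fun a _ => hi a, Finset.sum_congr rfl fun a _ => hA a]
    simp
  have hu : ∫ c, φ c * partialTrace s Finset.univ c ∂μ = s.card * ∫ c, φ c ∂μ := by
    rw [← integral_const_mul]
    refine integral_congr_ae ?_
    filter_upwards [ae_nonDegenerate] with c hc
    rw [partialTrace, sum_gramEntry_self s hc, mul_comm]
  rw [hs] at hu ⊢
  rw [Finset.card_univ, Fintype.card_fin] at hu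
  have hn0 : (n : ℝ) ≠ 0 := by positivity
  field_simp
  linear_combination (T.card : ℝ) * hu

/-- The solution of the linear system of `exists_gramEntry_moments`. -/
theorem moment_solve {n A B C k Q : ℝ} (hn : 2 ≤ n) (h1 : A = B + 2 * C)
    (h2 : n * A + n * (n - 1) * B = k ^ 2 * Q) (h3 : n * A + n * (n - 1) * C = k * Q) :
    A = (k ^ 2 + 2 * k) * Q / (n * (n + 2)) ∧
    C = k * (n - k) * Q / (n * (n - 1) * (n + 2)) := by
  have hA : A = (k ^ 2 + 2 * k) * Q / (n * (n + 2)) := by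
    rw [eq_div_iff (by positivity)]
    subst h1
    linear_combination h2 + 2 * h3
  refine ⟨hA, ?_⟩
  have hn1 : 0 < n - 1 := by linarith
  rw [eq_div_iff (by positivity)]
  rw [eq_div_iff (by positivity)] at hA
  linear_combination (n + 2) * h3 - hA

end SecondMoments

/-! ### Bounds for partial traces -/

section TraceBounds

variable {n : ℕ}

/-- The second moment of an off-diagonal entry, as found in `moment_solve`, is at most
`k * Q / n ^ 2`. This needs `k` to be `0` or at least `1`. -/
theorem off_diagonal_le {n k Q : ℝ} (hn : 2 ≤ n) (hk : k = 0 ∨ 1 ≤ k) (hQ : 0 ≤ Q) :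
    k * (n - k) * Q / (n * (n - 1) * (n + 2)) ≤ k * Q / n ^ 2 := by
  have hn1 : 0 < n - 1 := by linarith
  rcases hk with rfl | hk
  · simp
  rw [div_le_div_iff₀ (by positivity) (by positivity)]
  have h : n * (n - k) ≤ (n - 1) * (n + 2) := by nlinarith
  have h2 : 0 ≤ k * Q * n := by positivity
  nlinarith [mul_le_mul_of_nonneg_left h h2]

theorem nat_zero_or_one_le (k : ℕ) : (k : ℝ) = 0 ∨ (1 : ℝ) ≤ k := by
  rcases Nat.eq_zero_or_pos k with h | h
  · left; simp [h]
  · right; exact_mod_cast h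

theorem integral_mul_sum_sum_gramEntry {φ : (Fin n → EuclideanSpace ℝ (Fin n)) → ℝ}
    (hφ : HasMoments φ (columnLaw n)) (s T : Finset (Fin n)) (f g : Fin n → Fin n → Fin n × Fin n) :
    ∫ c, φ c * ∑ a ∈ T, ∑ b ∈ T, gramEntry s c (f a b).1 (f a b).2 *
        gramEntry s c (g a b).1 (g a b).2 ∂(columnLaw n)
      = ∑ a ∈ T, ∑ b ∈ T, ∫ c, φ c * (gramEntry s c (f a b).1 (f a b).2 *
        gramEntry s c (g a b).1 (g a b).2) ∂(columnLaw n) := by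
  have hi : ∀ a b, HasMoments (fun c => φ c * (gramEntry s c (f a b).1 (f a b).2 *
        gramEntry s c (g a b).1 (g a b).2)) (columnLaw n) :=
    fun a b => hφ.mul ((hasMoments_gramEntry s _ _).mul (hasMoments_gramEntry s _ _))
  simp_rw [Finset.mul_sum]
  rw [HasMoments.integral_sum _ fun a _ => HasMoments.sum _ fun b _ => hi a b]
  exact Finset.sum_congr rfl fun a _ => HasMoments.integral_sum _ fun b _ => hi a b

theorem integral_mul_partialTrace_sq_le (hn : 2 ≤ n)
    {φ : (Fin n → EuclideanSpace ℝ (Fin n)) → ℝ} (hφ : HasMoments φ (columnLaw n))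
    (hφ0 : ∀ c, 0 ≤ φ c)
    (hinv : ∀ (L : EuclideanSpace ℝ (Fin n) ≃ₗᵢ[ℝ] EuclideanSpace ℝ (Fin n)) c,
      φ (fun i => L (c i)) = φ c) (s T : Finset (Fin n)) :
    ∫ c, φ c * partialTrace s T c ^ 2 ∂(columnLaw n)
      ≤ 3 * T.card ^ 2 * s.card ^ 2 / n ^ 2 * ∫ c, φ c ∂(columnLaw n) := by
  obtain ⟨A, B, C, hA, hB, hC, h1, h2, h3⟩ := exists_gramEntry_moments hn hφ hinv s
  have hn' : (2 : ℝ) ≤ n := by exact_mod_cast hn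
  obtain ⟨eA, eC⟩ := moment_solve hn' h1 h2 h3
  have hQ : 0 ≤ ∫ c, φ c ∂(columnLaw n) := integral_nonneg hφ0
  set Q := ∫ c, φ c ∂(columnLaw n)
  have hC0 : 0 ≤ C := by
    rw [← hC ⟨0, by omega⟩ ⟨1, by omega⟩ (by simp [Fin.ext_iff])]
    exact integral_nonneg fun c => mul_nonneg (hφ0 c) (mul_self_nonneg _)
  have e : ∫ c, φ c * partialTrace s T c ^ 2 ∂(columnLaw n)
      = T.card * A + T.card * (T.card - 1) * B := by
    rw [← sum_sum_eq_card T hA hB, ← integral_mul_sum_sum_gramEntry hφ s T (fun a _ => (a, a))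
      (fun _ b => (b, b))]
    simp_rw [partialTrace, sq, Finset.sum_mul_sum]
  have hp := nat_zero_or_one_le T.card
  have hk := nat_zero_or_one_le s.card
  have hk2 : ((s.card : ℝ) ^ 2 + 2 * s.card) ≤ 3 * s.card ^ 2 := by
    rcases hk with h | h
    · simp [h]
    · nlinarith
  have hpp : (0 : ℝ) ≤ T.card * (T.card - 1) := by
    rcases hp with h | h
    · simp [h]
    · exact mul_nonneg (by linarith) (by linarith)
  have hA2 : A ≤ 3 * s.card ^ 2 * Q / n ^ 2 := by
    rw [eA]
    refine div_le_div₀ (by positivity) (mul_le_mul_of_nonneg_right hk2 hQ) (by positivity) ?_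
    nlinarith
  calc ∫ c, φ c * partialTrace s T c ^ 2 ∂(columnLaw n)
      = T.card * A + T.card * (T.card - 1) * B := e
    _ ≤ T.card * A + T.card * (T.card - 1) * A := by
        have : B ≤ A := by linarith
        nlinarith
    _ = T.card ^ 2 * A := by ring
    _ ≤ T.card ^ 2 * (3 * s.card ^ 2 * Q / n ^ 2) := by gcongr
    _ = _ := by ring

theorem integral_partialTrace (hn : 0 < n) (s T : Finset (Fin n)) :
    ∫ c, partialTrace s T c ∂(columnLaw n) = T.card * s.card / n := by
  simpa using integral_mul_partialTrace hn (hasMoments_const (1 : ℝ)) (fun _ _ => rfl) s T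

/-- The variance of a partial trace is at most `2 * p * C`, where `C` is the second moment of an
off-diagonal entry: the covariance of distinct diagonal entries is nonpositive. -/
theorem integral_partialTrace_sub_sq_le (hn : 2 ≤ n) (s T : Finset (Fin n)) :
    ∫ c, (partialTrace s T c - T.card * s.card / n) ^ 2 ∂(columnLaw n)
      ≤ 2 * T.card * s.card / n ^ 2 := by
  obtain ⟨A, B, C, hA, hB, hC, h1, h2, h3⟩ :=
    exists_gramEntry_moments hn (hasMoments_const (1 : ℝ)) (fun _ _ => rfl) s
  have hn' : (2 : ℝ) ≤ n := by exact_mod_cast hn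
  obtain ⟨eA, eC⟩ := moment_solve hn' h1 h2 h3
  simp only [integral_const, probReal_univ, smul_eq_mul, mul_one] at eA eC h2 h3
  have e : ∫ c, partialTrace s T c ^ 2 ∂(columnLaw n)
      = T.card * A + T.card * (T.card - 1) * B := by
    rw [← sum_sum_eq_card T hA hB, ← integral_mul_sum_sum_gramEntry (hasMoments_const (1 : ℝ)) s T
      (fun a _ => (a, a)) (fun _ b => (b, b))]
    simp_rw [partialTrace, sq, Finset.sum_mul_sum, one_mul]
  have hm := hasMoments_partialTrace s T
  have hk := nat_zero_or_one_le s.card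
  set p := (T.card : ℝ)
  set k := (s.card : ℝ) with hkdef
  have hkn : k ≤ n := by
    have := Finset.card_le_univ s
    rw [Fintype.card_fin] at this
    exact Nat.cast_le.2 this
  have hk0 : 0 ≤ k := Nat.cast_nonneg _
  have hp0 : 0 ≤ p := Nat.cast_nonneg _
  have e2 : ∫ c, (partialTrace s T c - p * k / n) ^ 2 ∂(columnLaw n)
      = p * A + p * (p - 1) * B - (p * k / n) ^ 2 := by
    simp_rw [show ∀ x : ℝ, (x - p * k / n) ^ 2
      = x ^ 2 - (2 * (p * k / n)) * x + (p * k / n) ^ 2 by intro x; ring]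
    rw [((hm.pow 2).sub (hm.const_mul _)).integral_add (hasMoments_const _),
      (hm.pow 2).integral_sub (hm.const_mul _), integral_const_mul, e,
      integral_partialTrace (by omega)]
    simp only [integral_const, probReal_univ, smul_eq_mul, one_mul]
    ring
  have hCle : C ≤ k / n ^ 2 := by
    have := off_diagonal_le (Q := 1) hn' hk zero_le_one
    rw [eC]
    simpa using this
  have hn1 : (0 : ℝ) < n - 1 := by linarith
  have hBle : B ≤ (k / n) ^ 2 := by
    have hB' : B = (k ^ 2 * (n + 1) - 2 * k) / (n * (n - 1) * (n + 2)) := by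
      rw [eq_div_iff (by positivity)]
      rw [eq_div_iff (by positivity)] at eA
      linear_combination (n + 2) * h2 - eA
    rw [hB', div_pow, div_le_div_iff₀ (by positivity) (by positivity)]
    have : 0 ≤ k * n * (n - k) := by
      have : (0 : ℝ) ≤ n - k := by linarith
      positivity
    nlinarith
  rw [e2]
  calc p * A + p * (p - 1) * B - (p * k / n) ^ 2
      = p * (2 * C) + p ^ 2 * (B - (k / n) ^ 2) := by rw [h1]; ring
    _ ≤ p * (2 * (k / n ^ 2)) + 0 := by
        refine add_le_add (by gcongr) ?_
        exact mul_nonpos_of_nonneg_of_nonpos (by positivity) (by linarith)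
    _ = _ := by ring

theorem integral_sum_sum_gramEntry_sq_le (hn : 2 ≤ n) (s T : Finset (Fin n)) :
    ∫ c, ∑ a ∈ T, ∑ b ∈ T, gramEntry s c a b ^ 2 ∂(columnLaw n)
      ≤ 3 * T.card * s.card ^ 2 / n ^ 2 + T.card ^ 2 * s.card / n ^ 2 := by
  obtain ⟨A, B, C, hA, hB, hC, h1, h2, h3⟩ :=
    exists_gramEntry_moments hn (hasMoments_const (1 : ℝ)) (fun _ _ => rfl) s
  have hn' : (2 : ℝ) ≤ n := by exact_mod_cast hn
  obtain ⟨eA, eC⟩ := moment_solve hn' h1 h2 h3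
  simp only [integral_const, probReal_univ, smul_eq_mul, mul_one] at eA eC
  have e : ∫ c, ∑ a ∈ T, ∑ b ∈ T, gramEntry s c a b ^ 2 ∂(columnLaw n)
      = T.card * A + T.card * (T.card - 1) * C := by
    rw [← sum_sum_eq_card T hA hC, ← integral_mul_sum_sum_gramEntry (hasMoments_const (1 : ℝ)) s T
      (fun a b => (a, b)) (fun a b => (a, b))]
    simp_rw [sq, one_mul]
  have hk := nat_zero_or_one_le s.card
  have hk2 : ((s.card : ℝ) ^ 2 + 2 * s.card) ≤ 3 * s.card ^ 2 := by
    rcases hk with h | h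
    · simp [h]
    · nlinarith
  have hCle : C ≤ s.card / n ^ 2 := by
    have := off_diagonal_le (Q := 1) hn' hk zero_le_one
    rw [eC]
    simpa using this
  have hC0 : 0 ≤ C := by
    rw [← hC ⟨0, by omega⟩ ⟨1, by omega⟩ (by simp [Fin.ext_iff])]
    exact integral_nonneg fun c => mul_nonneg zero_le_one (mul_self_nonneg _)
  have hA2 : A ≤ 3 * s.card ^ 2 / n ^ 2 := by
    rw [eA]
    refine div_le_div₀ (by positivity) hk2 (by positivity) ?_
    nlinarith
  rw [e]
  have hp : (0 : ℝ) ≤ T.card := Nat.cast_nonneg _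
  calc T.card * A + T.card * (T.card - 1) * C
      ≤ T.card * A + T.card ^ 2 * C := by nlinarith [mul_nonneg hp hC0]
    _ ≤ T.card * (3 * s.card ^ 2 / n ^ 2) + T.card ^ 2 * (s.card / n ^ 2) := by gcongr
    _ = _ := by ring

end TraceBounds

/-! ### Conditional moments given the preceding columns -/

section Conditional

variable {n : ℕ} {c : Fin n → EuclideanSpace ℝ (Fin n)}

theorem prevProj_apply (c : Fin n → EuclideanSpace ℝ (Fin n)) (j : Fin n)
    (y : EuclideanSpace ℝ (Fin n)) (a : Fin n) :
    prevProj c j y a = ⟪prevProj c j (EuclideanSpace.single a 1), y⟫ := by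
  simp [prevProj, sum_inner, real_inner_smul_left, EuclideanSpace.inner_single_right, mul_comm]

theorem prevProj_add (j : Fin n) (x y : EuclideanSpace ℝ (Fin n)) :
    prevProj c j (x + y) = prevProj c j x + prevProj c j y := by
  simp only [prevProj, inner_add_right, add_smul, Finset.sum_add_distrib]

theorem prevProj_smul (j : Fin n) (r : ℝ) (y : EuclideanSpace ℝ (Fin n)) :
    prevProj c j (r • y) = r • prevProj c j y := by
  simp only [prevProj, inner_smul_right, Finset.smul_sum, mul_smul]

theorem inner_gramSchmidtNormed_prevProj (hc : NonDegenerate c) {i j : Fin n} (hij : i < j)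
    (y : EuclideanSpace ℝ (Fin n)) :
    ⟪gramSchmidtNormed ℝ c i, prevProj c j y⟫ = ⟪gramSchmidtNormed ℝ c i, y⟫ := by
  rw [prevProj, inner_sum, Finset.sum_eq_single_of_mem i (Finset.mem_Iio.2 hij)]
  · rw [inner_smul_right, real_inner_self_eq_norm_sq, hc.orthonormal.1 i]; simp
  · intro k _ hk
    rw [inner_smul_right, hc.orthonormal.2 hk.symm, mul_zero]

theorem inner_prevProj_prevProj (hc : NonDegenerate c) (j : Fin n)
    (x y : EuclideanSpace ℝ (Fin n)) :
    ⟪prevProj c j x, prevProj c j y⟫ = gramForm (Finset.Iio j) c x y := by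
  conv_lhs => rw [prevProj, sum_inner]
  refine Finset.sum_congr rfl fun i hi => ?_
  rw [real_inner_smul_left, inner_gramSchmidtNormed_prevProj hc (Finset.mem_Iio.1 hi)]

theorem inner_prevProj_left (j : Fin n) (x y : EuclideanSpace ℝ (Fin n)) :
    ⟪prevProj c j x, y⟫ = gramForm (Finset.Iio j) c x y := by
  rw [prevProj, sum_inner]
  exact Finset.sum_congr rfl fun i _ => by rw [real_inner_smul_left]

theorem prevProj_prevProj (hc : NonDegenerate c) (j : Fin n) (y : EuclideanSpace ℝ (Fin n)) :
    prevProj c j (prevProj c j y) = prevProj c j y := by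
  conv_lhs => rw [prevProj]
  conv_rhs => rw [prevProj]
  exact Finset.sum_congr rfl fun i hi => by
    rw [inner_gramSchmidtNormed_prevProj hc (Finset.mem_Iio.1 hi)]

/-- The squared length of the part in the rows `T` of the projection of `y` to the span of the
preceding columns. -/
noncomputable def blockSq (T : Finset (Fin n)) (c : Fin n → EuclideanSpace ℝ (Fin n)) (j : Fin n)
    (y : EuclideanSpace ℝ (Fin n)) : ℝ :=
  ∑ a ∈ T, prevProj c j y a ^ 2

theorem hasMoments_prevProj_stdGaussian (c : Fin n → EuclideanSpace ℝ (Fin n)) (j a : Fin n) :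
    HasMoments (fun y => prevProj c j y a) (stdGaussian (EuclideanSpace ℝ (Fin n))) := by
  simp_rw [prevProj_apply]
  exact hasMoments_inner_stdGaussian _

theorem hasMoments_blockSq_stdGaussian (T : Finset (Fin n))
    (c : Fin n → EuclideanSpace ℝ (Fin n)) (j : Fin n) :
    HasMoments (blockSq T c j) (stdGaussian (EuclideanSpace ℝ (Fin n))) :=
  HasMoments.sum _ fun a _ => (hasMoments_prevProj_stdGaussian c j a).pow 2

theorem hasMoments_blockSq (T : Finset (Fin n)) (j : Fin n) :
    HasMoments (fun c => blockSq T c j (c j)) (columnLaw n) :=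
  HasMoments.sum _ fun a _ => (hasMoments_prevProj_apply j a).pow 2

theorem integral_blockSq (hc : NonDegenerate c) (T : Finset (Fin n)) (j : Fin n) :
    ∫ y, blockSq T c j y ∂(stdGaussian (EuclideanSpace ℝ (Fin n)))
      = partialTrace (Finset.Iio j) T c := by
  simp_rw [blockSq]
  rw [HasMoments.integral_sum _ fun a _ => (hasMoments_prevProj_stdGaussian c j a).pow 2]
  refine Finset.sum_congr rfl fun a _ => ?_
  simp_rw [prevProj_apply]
  rw [integral_inner_sq_stdGaussian, ← real_inner_self_eq_norm_sq, inner_prevProj_prevProj hc,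
    gramEntry]

theorem integral_blockSq_sq (hc : NonDegenerate c) (T : Finset (Fin n)) (j : Fin n) :
    ∫ y, blockSq T c j y ^ 2 ∂(stdGaussian (EuclideanSpace ℝ (Fin n)))
      = partialTrace (Finset.Iio j) T c ^ 2
        + 2 * ∑ a ∈ T, ∑ b ∈ T, gramEntry (Finset.Iio j) c a b ^ 2 := by
  have hi : ∀ a b, HasMoments (fun y => prevProj c j y a ^ 2 * prevProj c j y b ^ 2)
      (stdGaussian (EuclideanSpace ℝ (Fin n))) := fun a b =>
    ((hasMoments_prevProj_stdGaussian c j a).pow 2).mul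
      ((hasMoments_prevProj_stdGaussian c j b).pow 2)
  simp_rw [blockSq, sq (∑ a ∈ T, _), Finset.sum_mul_sum]
  rw [HasMoments.integral_sum _ fun a _ => HasMoments.sum _ fun b _ => hi a b,
    partialTrace, sq (∑ a ∈ T, _), Finset.sum_mul_sum, Finset.mul_sum, ← Finset.sum_add_distrib]
  refine Finset.sum_congr rfl fun a _ => ?_
  rw [HasMoments.integral_sum _ fun b _ => hi a b, Finset.mul_sum, ← Finset.sum_add_distrib]
  refine Finset.sum_congr rfl fun b _ => ?_
  simp_rw [prevProj_apply]
  rw [integral_inner_sq_mul_inner_sq_stdGaussian, ← real_inner_self_eq_norm_sq,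
    ← real_inner_self_eq_norm_sq]
  simp_rw [inner_prevProj_prevProj hc, gramEntry]

/-- Negating the component of `y` in the span of the preceding columns is an isometry. -/
theorem exists_reflection (hc : NonDegenerate c) (j : Fin n) :
    ∃ L : EuclideanSpace ℝ (Fin n) ≃ₗᵢ[ℝ] EuclideanSpace ℝ (Fin n),
      ∀ y, L y = y - (2 : ℝ) • prevProj c j y := by
  let f : EuclideanSpace ℝ (Fin n) →ₗ[ℝ] EuclideanSpace ℝ (Fin n) :=
    { toFun := fun y => y - (2 : ℝ) • prevProj c j y
      map_add' := fun x y => by rw [prevProj_add, smul_add]; abel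
      map_smul' := fun r y => by
        rw [prevProj_smul, RingHom.id_apply, smul_sub, smul_comm] }
  have hf : ∀ y, ‖f y‖ = ‖y‖ := by
    intro y
    have : ‖f y‖ ^ 2 = ‖y‖ ^ 2 := by
      change ‖y - (2 : ℝ) • prevProj c j y‖ ^ 2 = ‖y‖ ^ 2
      rw [norm_sub_sq_real, norm_smul, inner_smul_right, real_inner_comm, inner_prevProj_left,
        mul_pow, ← real_inner_self_eq_norm_sq (prevProj c j y), inner_prevProj_prevProj hc]
      norm_num
      ring
    exact (pow_left_inj₀ (norm_nonneg _) (norm_nonneg _) two_ne_zero).1 this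
  exact ⟨LinearIsometry.toLinearIsometryEquiv ⟨f, hf⟩ rfl, fun y => rfl⟩

/-- The component of a Gaussian vector in the span of the preceding columns has a symmetric law
given the orthogonal component. No integrability of `F` is needed: the integral equals its own
negative in any case. -/
theorem integral_comp_sub_prevProj_mul_prevProj (hc : NonDegenerate c) (j a : Fin n)
    (F : EuclideanSpace ℝ (Fin n) → ℝ) :
    ∫ y, F (y - prevProj c j y) * prevProj c j y a
      ∂(stdGaussian (EuclideanSpace ℝ (Fin n))) = 0 := by
  obtain ⟨L, hL⟩ := exists_reflection hc j
  have hP : ∀ y, prevProj c j (L y) = -prevProj c j y := by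
    intro y
    rw [hL, sub_eq_add_neg, ← smul_neg, prevProj_add, prevProj_smul, ← neg_one_smul ℝ,
      prevProj_smul, prevProj_prevProj hc]
    module
  have h := L.toHomeomorph.measurableEmbedding.integral_map
    (μ := stdGaussian (EuclideanSpace ℝ (Fin n)))
    (fun y => F (y - prevProj c j y) * prevProj c j y a)
  have hL2 : (L.toHomeomorph : EuclideanSpace ℝ (Fin n) → EuclideanSpace ℝ (Fin n)) = L := rfl
  rw [hL2, stdGaussian_map L] at h
  have e : ∀ y, F (L y - prevProj c j (L y)) * prevProj c j (L y) a
      = -(F (y - prevProj c j y) * prevProj c j y a) := by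
    intro y
    rw [hP, hL, show y - (2 : ℝ) • prevProj c j y - -prevProj c j y = y - prevProj c j y by module,
      PiLp.neg_apply, mul_neg]
  simp_rw [e] at h
  rw [integral_neg] at h
  linarith

/-- Given the preceding columns, `‖gramSchmidt ℝ c j‖ ^ 2` is chi-squared with `n - j` degrees of
freedom: in an orthonormal basis adapted to the columns, it is the sum of the squares of the
coordinates with index at least `j`. -/
theorem integral_norm_gramSchmidt_pow (j : Fin n) (k : ℕ) :
    ∫ c, (‖gramSchmidt ℝ c j‖ ^ 2 - n) ^ k ∂(columnLaw n)
      = ∫ x, (chiSqCentred (Finset.Ici j) x - j) ^ k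
        ∂(Measure.pi fun _ : Fin n => gaussianReal 0 1) := by
  have hm := ((((hasMoments_norm_gramSchmidt j).pow 2).sub (hasMoments_const (n : ℝ))).pow k)
  rw [integral_columnLaw_eq j hm.integrable (G := fun _ => _) fun c hc => ?_]
  · rw [integral_const, probReal_univ, one_smul]
  obtain ⟨b, hb⟩ := hc.exists_basis
  simp_rw [gramSchmidt_eq_sub_prevProj, prevProj_update c le_rfl, Function.update_self]
  have hmeas : Continuous fun y : EuclideanSpace ℝ (Fin n) =>
      (‖y - prevProj c j y‖ ^ 2 - n) ^ k := by
    unfold prevProj; fun_prop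
  rw [stdGaussian_eq_map_pi_orthonormalBasis b,
    integral_map (Continuous.aemeasurable (by fun_prop)) hmeas.aestronglyMeasurable]
  refine integral_congr_ae (Eventually.of_forall fun x => ?_)
  simp only
  congr 1
  have hin : ∀ i, ⟪b i, ∑ k, x k • b k⟫ = x i := fun i => b.orthonormal.inner_right_fintype x i
  have hsub : (∑ i, x i • b i) - prevProj c j (∑ i, x i • b i) = ∑ i ∈ Finset.Ici j, x i • b i := by
    rw [prevProj, sub_eq_iff_eq_add']
    simp_rw [hb, hin]
    rw [← Finset.sum_union]
    · refine Finset.sum_congr ?_ fun _ _ => rfl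
      ext i; simp [lt_or_ge]
    · rw [Finset.disjoint_left]
      intro i hi hi'
      exact absurd (Finset.mem_Iio.1 hi) (not_lt.2 (Finset.mem_Ici.1 hi'))
  rw [hsub, ← real_inner_self_eq_norm_sq, b.orthonormal.inner_sum]
  simp only [chiSqCentred, Finset.sum_sub_distrib, Finset.sum_const, Fin.card_Ici, nsmul_eq_mul,
    mul_one, conj_trivial, Nat.cast_sub j.2.le, sq]
  ring

theorem integral_norm_gramSchmidt_moments (j : Fin n) :
    ∫ c, (‖gramSchmidt ℝ c j‖ ^ 2 - n) ^ 2 ∂(columnLaw n) = 2 * (n - j) + j ^ 2 ∧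
    ∫ c, (‖gramSchmidt ℝ c j‖ ^ 2 - n) ^ 3 ∂(columnLaw n) ≤ 8 * (n - j) ∧
    ∫ c, (‖gramSchmidt ℝ c j‖ ^ 2 - n) ^ 4 ∂(columnLaw n) ≤ 8 * (j ^ 4 + 60 * n ^ 2) := by
  obtain ⟨w1, w2, w3, w4⟩ := integral_chiSqCentred_pow (Finset.Ici j)
  have hm : HasMoments (chiSqCentred (Finset.Ici j)) (Measure.pi fun _ : Fin n => gaussianReal 0 1) :=
    hasMoments_chiSqCentred _
  simp_rw [integral_norm_gramSchmidt_pow]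
  rw [Fin.card_Ici, Nat.cast_sub j.2.le] at w2 w3 w4
  set W := chiSqCentred (Finset.Ici j)
  set π := Measure.pi fun _ : Fin n => gaussianReal 0 1
  have hj : (j : ℝ) ≤ n := by exact_mod_cast j.2.le
  have hj0 : (0 : ℝ) ≤ j := Nat.cast_nonneg _
  have one : ∀ r : ℝ, ∫ _, r ∂π = r := by simp
  refine ⟨?_, ?_, ?_⟩
  · simp_rw [show ∀ x, (W x - j) ^ 2 = W x ^ 2 - 2 * j * W x + j ^ 2 by intro x; ring]
    rw [((hm.pow 2).sub (hm.const_mul _)).integral_add (hasMoments_const _),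
      (hm.pow 2).integral_sub (hm.const_mul _), integral_const_mul, w1, w2, one]
    ring
  · simp_rw [show ∀ x, (W x - j) ^ 3 = W x ^ 3 - 3 * j * W x ^ 2 + 3 * j ^ 2 * W x - j ^ 3 by
      intro x; ring]
    rw [(((hm.pow 3).sub ((hm.pow 2).const_mul _)).add (hm.const_mul _)).integral_sub
        (hasMoments_const _),
      ((hm.pow 3).sub ((hm.pow 2).const_mul _)).integral_add (hm.const_mul _),
      (hm.pow 3).integral_sub ((hm.pow 2).const_mul _), integral_const_mul, integral_const_mul,
      w1, w2, w3, one]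
    have : (0 : ℝ) ≤ n - j := by linarith
    have h1 : (0 : ℝ) ≤ 3 * j * (2 * (n - j)) := by positivity
    have h2 : (0 : ℝ) ≤ (j : ℝ) ^ 3 := by positivity
    linarith
  · calc ∫ x, (W x - j) ^ 4 ∂π ≤ ∫ x, 8 * (W x ^ 4 + (j : ℝ) ^ 4) ∂π := by
          refine integral_mono ((hm.sub (hasMoments_const _)).pow 4).integrable
            (((hm.pow 4).add (hasMoments_const _)).const_mul 8).integrable fun x => ?_
          have h1 : (W x - j) ^ 2 ≤ 2 * (W x ^ 2 + j ^ 2) := by nlinarith [sq_nonneg (W x + j)]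
          have h2 : ((W x - j) ^ 2) ^ 2 ≤ (2 * (W x ^ 2 + j ^ 2)) ^ 2 :=
            pow_le_pow_left₀ (sq_nonneg _) h1 2
          nlinarith [sq_nonneg (W x ^ 2 - (j : ℝ) ^ 2)]
      _ = 8 * (12 * (n - j) ^ 2 + 48 * (n - j) + j ^ 4) := by
          rw [integral_const_mul, (hm.pow 4).integral_add (hasMoments_const _), w4, one]
      _ ≤ 8 * (j ^ 4 + 60 * n ^ 2) := by
          have hn1 : (1 : ℝ) ≤ n := by
            have : 1 ≤ n := by have := j.2; omega
            exact_mod_cast this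
          nlinarith

end Conditional

/-! ### The normalization defect -/

section Defect

variable {n : ℕ}

theorem sub_sq_le_of_sq {a R : ℝ} (ha : 0 < a) (hR : 0 ≤ R) :
    (a - R) ^ 2 ≤ (R ^ 2 - a ^ 2) ^ 2 / a ^ 2 := by
  rw [le_div_iff₀ (by positivity), show R ^ 2 - a ^ 2 = (R - a) * (R + a) by ring, mul_pow,
    show (a - R) ^ 2 = (R - a) ^ 2 by ring]
  exact mul_le_mul_of_nonneg_left (pow_le_pow_left₀ ha.le (by linarith) 2) (sq_nonneg _)

/-- The third order Taylor estimate of the square root at `a ^ 2`, which bounds `(a - R) ^ 2` from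
below by a polynomial in `R ^ 2`. -/
theorem le_sub_sq_of_sq {a R : ℝ} (ha : 0 < a) (hR : 0 ≤ R) :
    ((R ^ 2 - a ^ 2) ^ 2 - (R ^ 2 - a ^ 2) ^ 3 / (2 * a ^ 2)) / (4 * a ^ 2) ≤ (a - R) ^ 2 := by
  have h : (a - R) ^ 2 - ((R ^ 2 - a ^ 2) ^ 2 - (R ^ 2 - a ^ 2) ^ 3 / (2 * a ^ 2)) / (4 * a ^ 2)
      = (R - a) ^ 4 * (R ^ 2 + 4 * a * R + 5 * a ^ 2) / (8 * a ^ 4) := by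
    field_simp
    ring
  have : 0 ≤ (R - a) ^ 4 * (R ^ 2 + 4 * a * R + 5 * a ^ 2) / (8 * a ^ 4) := by positivity
  linarith

/-- The squared deviation of the length of the `j`-th Gram-Schmidt vector from `√n`. -/
noncomputable def defectSq (j : Fin n) (c : Fin n → EuclideanSpace ℝ (Fin n)) : ℝ :=
  (√(n : ℝ) - ‖gramSchmidt ℝ c j‖) ^ 2

theorem hasMoments_defectSq (j : Fin n) : HasMoments (defectSq j) (columnLaw n) :=
  ((hasMoments_const _).sub (hasMoments_norm_gramSchmidt j)).pow 2

theorem defectSq_map (j : Fin n)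
    (L : EuclideanSpace ℝ (Fin n) ≃ₗᵢ[ℝ] EuclideanSpace ℝ (Fin n))
    (c : Fin n → EuclideanSpace ℝ (Fin n)) : defectSq j (fun i => L (c i)) = defectSq j c := by
  rw [defectSq, gramSchmidt_map, L.norm_map, defectSq]

theorem hasMoments_norm_sq_sub_pow (j : Fin n) (k : ℕ) :
    HasMoments (fun c => (‖gramSchmidt ℝ c j‖ ^ 2 - n) ^ k) (columnLaw n) :=
  (((hasMoments_norm_gramSchmidt j).pow 2).sub (hasMoments_const (n : ℝ))).pow k

theorem integral_defectSq_le (j : Fin n) :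
    ∫ c, defectSq j c ∂(columnLaw n) ≤ 2 + j ^ 2 / n := by
  have hn : (0 : ℝ) < n := by exact_mod_cast j.pos
  have hs := Real.sq_sqrt hn.le
  calc ∫ c, defectSq j c ∂(columnLaw n)
      ≤ ∫ c, 1 / (n : ℝ) * (‖gramSchmidt ℝ c j‖ ^ 2 - n) ^ 2 ∂(columnLaw n) := by
        refine integral_mono (hasMoments_defectSq j).integrable
          ((hasMoments_norm_sq_sub_pow j 2).const_mul _).integrable fun c => ?_
        have := sub_sq_le_of_sq (Real.sqrt_pos.2 hn) (norm_nonneg (gramSchmidt ℝ c j))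
        rw [hs] at this
        simp only
        rw [one_div_mul_eq_div]
        exact this
    _ = 1 / n * (2 * (n - j) + j ^ 2) := by
        rw [integral_const_mul, (integral_norm_gramSchmidt_moments j).1]
    _ ≤ 2 + j ^ 2 / n := by
        have hj : (0 : ℝ) ≤ (j : ℝ) := Nat.cast_nonneg _
        rw [one_div_mul_eq_div, div_le_iff₀ hn, add_mul, div_mul_cancel₀ _ hn.ne']
        linarith

/-- The mean of the squared defect is close to `1 / 2` for `j` small compared with `n`. A positive
lower bound of this order is what makes up, when `q` stays bounded, for the difference between
`p * q * (q - 1) / (2 * n)` and `p * q ^ 2 / (2 * n)`. -/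
theorem le_integral_defectSq (j : Fin n) :
    1 / 2 * (1 - j / n) * (1 - 2 / n) ≤ ∫ c, defectSq j c ∂(columnLaw n) := by
  have hn : (0 : ℝ) < n := by exact_mod_cast j.pos
  have hs := Real.sq_sqrt hn.le
  obtain ⟨m2, m3, -⟩ := integral_norm_gramSchmidt_moments j
  calc 1 / 2 * (1 - j / n) * (1 - 2 / n)
      = 1 / (4 * (n : ℝ)) * (2 * (n - j) - 1 / (2 * n) * (8 * (n - j))) := by field_simp; ring
    _ ≤ 1 / (4 * (n : ℝ)) * ((2 * (n - j) + j ^ 2) -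
        1 / (2 * n) * ∫ c, (‖gramSchmidt ℝ c j‖ ^ 2 - n) ^ 3 ∂(columnLaw n)) := by
        gcongr
        nlinarith [sq_nonneg (j : ℝ)]
    _ = ∫ c, 1 / (4 * (n : ℝ)) * ((‖gramSchmidt ℝ c j‖ ^ 2 - n) ^ 2
          - 1 / (2 * (n : ℝ)) * (‖gramSchmidt ℝ c j‖ ^ 2 - n) ^ 3) ∂(columnLaw n) := by
        rw [integral_const_mul, (hasMoments_norm_sq_sub_pow j 2).integral_sub
          ((hasMoments_norm_sq_sub_pow j 3).const_mul _), integral_const_mul, m2]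
    _ ≤ ∫ c, defectSq j c ∂(columnLaw n) := by
        refine integral_mono (((hasMoments_norm_sq_sub_pow j 2).sub
          ((hasMoments_norm_sq_sub_pow j 3).const_mul _)).const_mul _).integrable
          (hasMoments_defectSq j).integrable fun c => ?_
        have := le_sub_sq_of_sq (Real.sqrt_pos.2 hn) (norm_nonneg (gramSchmidt ℝ c j))
        rw [hs] at this
        simp only
        rw [one_div_mul_eq_div, one_div_mul_eq_div]
        exact this

theorem integral_defectSq_sq_le (j : Fin n) :
    ∫ c, defectSq j c ^ 2 ∂(columnLaw n) ≤ 8 * ((j ^ 2 / n) ^ 2 + 60) := by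
  have hn : (0 : ℝ) < n := by exact_mod_cast j.pos
  have hs := Real.sq_sqrt hn.le
  calc ∫ c, defectSq j c ^ 2 ∂(columnLaw n)
      ≤ ∫ c, 1 / (n : ℝ) ^ 2 * (‖gramSchmidt ℝ c j‖ ^ 2 - n) ^ 4 ∂(columnLaw n) := by
        refine integral_mono ((hasMoments_defectSq j).pow 2).integrable
          ((hasMoments_norm_sq_sub_pow j 4).const_mul _).integrable fun c => ?_
        have := sub_sq_le_of_sq (Real.sqrt_pos.2 hn) (norm_nonneg (gramSchmidt ℝ c j))
        rw [hs] at this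
        have h2 := pow_le_pow_left₀ (sq_nonneg _) this 2
        simp only
        rw [one_div_mul_eq_div]
        refine h2.trans (le_of_eq ?_)
        rw [div_pow, ← pow_mul]
    _ ≤ 1 / (n : ℝ) ^ 2 * (8 * (j ^ 4 + 60 * n ^ 2)) := by
        rw [integral_const_mul]
        have := (integral_norm_gramSchmidt_moments j).2.2
        gcongr
    _ = 8 * ((j ^ 2 / n) ^ 2 + 60) := by
        field_simp

end Defect

/-! ### The squared distance and its two parts -/

section Distance

variable {n : ℕ}

/-- The part of the squared distance due to the projections to the preceding columns. -/
noncomputable def projPart (T J : Finset (Fin n)) (c : Fin n → EuclideanSpace ℝ (Fin n)) : ℝ :=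
  ∑ j ∈ J, blockSq T c j (c j)

/-- The part of the squared distance due to the normalization of the Gram-Schmidt vectors. The
factor `partialTrace {j} T` is the squared length of the `j`-th of them in the rows `T`. -/
noncomputable def defectPart (T J : Finset (Fin n)) (c : Fin n → EuclideanSpace ℝ (Fin n)) : ℝ :=
  ∑ j ∈ J, defectSq j c * partialTrace {j} T c

/-- The squared Hilbert-Schmidt distance of the blocks with rows in `T` and columns in `J`. -/
noncomputable def distSq (T J : Finset (Fin n)) (c : Fin n → EuclideanSpace ℝ (Fin n)) : ℝ :=
  ∑ j ∈ J, ∑ a ∈ T, (√(n : ℝ) * gramSchmidtNormed ℝ c j a - c j a) ^ 2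

variable (T J : Finset (Fin n))

theorem hasMoments_projPart : HasMoments (projPart T J) (columnLaw n) :=
  HasMoments.sum _ fun j _ => hasMoments_blockSq T j

theorem hasMoments_defectPart : HasMoments (defectPart T J) (columnLaw n) :=
  HasMoments.sum _ fun j _ => (hasMoments_defectSq j).mul (hasMoments_partialTrace _ _)

/-- The decomposition of an entry of `√n Γ - Y` into its normalization and projection parts. -/
theorem entry_eq (c : Fin n → EuclideanSpace ℝ (Fin n)) (j a : Fin n) :
    √(n : ℝ) * gramSchmidtNormed ℝ c j a - c j a
      = (√(n : ℝ) - ‖gramSchmidt ℝ c j‖) * gramSchmidtNormed ℝ c j a - prevProj c j (c j) a := by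
  have h1 := congrArg (fun v : EuclideanSpace ℝ (Fin n) => v a) (norm_smul_gramSchmidtNormed c j)
  have h2 := congrArg (fun v : EuclideanSpace ℝ (Fin n) => v a) (gramSchmidt_eq_sub_prevProj c j)
  simp only [PiLp.smul_apply, PiLp.sub_apply, smul_eq_mul] at h1 h2
  linarith

theorem partialTrace_singleton (c : Fin n → EuclideanSpace ℝ (Fin n)) (j : Fin n) :
    partialTrace {j} T c = ∑ a ∈ T, gramSchmidtNormed ℝ c j a ^ 2 := by
  refine Finset.sum_congr rfl fun a _ => ?_
  rw [gramEntry_eq, Finset.sum_singleton, sq]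

theorem projPart_eq (c : Fin n → EuclideanSpace ℝ (Fin n)) :
    projPart T J c = ∑ j ∈ J, ∑ a ∈ T, prevProj c j (c j) a ^ 2 := rfl

theorem defectPart_eq (c : Fin n → EuclideanSpace ℝ (Fin n)) :
    defectPart T J c = ∑ j ∈ J, ∑ a ∈ T,
      ((√(n : ℝ) - ‖gramSchmidt ℝ c j‖) * gramSchmidtNormed ℝ c j a) ^ 2 := by
  refine Finset.sum_congr rfl fun j _ => ?_
  rw [partialTrace_singleton, Finset.mul_sum]
  exact Finset.sum_congr rfl fun a _ => by rw [mul_pow]; rfl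

theorem projPart_nonneg (c : Fin n → EuclideanSpace ℝ (Fin n)) : 0 ≤ projPart T J c :=
  Finset.sum_nonneg fun _ _ => Finset.sum_nonneg fun _ _ => sq_nonneg _

theorem defectPart_nonneg (c : Fin n → EuclideanSpace ℝ (Fin n)) : 0 ≤ defectPart T J c := by
  rw [defectPart_eq]
  exact Finset.sum_nonneg fun _ _ => Finset.sum_nonneg fun _ _ => sq_nonneg _

theorem distSq_nonneg (c : Fin n → EuclideanSpace ℝ (Fin n)) : 0 ≤ distSq T J c :=
  Finset.sum_nonneg fun _ _ => Finset.sum_nonneg fun _ _ => sq_nonneg _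

theorem distSq_eq (c : Fin n → EuclideanSpace ℝ (Fin n)) :
    distSq T J c = projPart T J c + defectPart T J c - 2 * ∑ j ∈ J, ∑ a ∈ T,
      ((√(n : ℝ) - ‖gramSchmidt ℝ c j‖) * gramSchmidtNormed ℝ c j a) * prevProj c j (c j) a := by
  rw [projPart_eq, defectPart_eq, distSq]
  simp_rw [Finset.mul_sum, ← Finset.sum_add_distrib, ← Finset.sum_sub_distrib, entry_eq]
  exact Finset.sum_congr rfl fun j _ => Finset.sum_congr rfl fun a _ => by ring

theorem distSq_le (c : Fin n → EuclideanSpace ℝ (Fin n)) :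
    distSq T J c ≤ 2 * (projPart T J c + defectPart T J c) := by
  rw [projPart_eq, defectPart_eq, distSq]
  simp_rw [← Finset.sum_add_distrib, Finset.mul_sum, entry_eq]
  refine Finset.sum_le_sum fun j _ => Finset.sum_le_sum fun a _ => ?_
  nlinarith [sq_nonneg ((√(n : ℝ) - ‖gramSchmidt ℝ c j‖) * gramSchmidtNormed ℝ c j a
    + prevProj c j (c j) a)]

/-- The triangle inequality for the Hilbert-Schmidt norm. -/
theorem abs_sqrt_distSq_sub_le (c : Fin n → EuclideanSpace ℝ (Fin n)) :
    |√(distSq T J c) - √(projPart T J c)| ≤ √(defectPart T J c) := by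
  let x : EuclideanSpace ℝ (J × T) :=
    WithLp.toLp 2 fun z => (√(n : ℝ) - ‖gramSchmidt ℝ c z.1‖) * gramSchmidtNormed ℝ c z.1 z.2
  let y : EuclideanSpace ℝ (J × T) := WithLp.toLp 2 fun z => prevProj c z.1 (c z.1) z.2
  have hsum : ∀ F : Fin n → Fin n → ℝ,
      ∑ z : J × T, F z.1 z.2 = ∑ j ∈ J, ∑ a ∈ T, F j a := by
    intro F
    rw [Fintype.sum_prod_type, ← Finset.sum_coe_sort J]
    exact Finset.sum_congr rfl fun j _ => Finset.sum_coe_sort T (F j)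
  have hx : ‖x‖ = √(defectPart T J c) := by
    rw [EuclideanSpace.norm_eq, defectPart_eq, ← hsum]
    simp only [x, Real.norm_eq_abs, sq_abs]
  have hy : ‖y‖ = √(projPart T J c) := by
    rw [EuclideanSpace.norm_eq, projPart_eq, ← hsum]
    simp only [y, Real.norm_eq_abs, sq_abs]
  have hxy : ‖y - x‖ = √(distSq T J c) := by
    rw [EuclideanSpace.norm_eq, distSq]
    simp_rw [entry_eq]
    rw [← hsum]
    congr 1
    refine Finset.sum_congr rfl fun z _ => ?_
    simp only [x, y, PiLp.sub_apply, Real.norm_eq_abs, sq_abs]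
    ring
  rw [← hx, ← hy, ← hxy]
  have := abs_norm_sub_norm_le (y - x) y
  simpa using this

theorem integral_projPart :
    ∫ c, projPart T J c ∂(columnLaw n) = ∑ j ∈ J, (T.card * j / n : ℝ) := by
  simp_rw [projPart]
  rw [HasMoments.integral_sum _ fun j _ => hasMoments_blockSq T j]
  refine Finset.sum_congr rfl fun j _ => ?_
  rw [integral_columnLaw_eq j (hasMoments_blockSq T j).integrable
    (G := partialTrace (Finset.Iio j) T), integral_partialTrace j.pos, Fin.card_Iio]
  intro c hc
  rw [← integral_blockSq hc]
  simp only [blockSq, Function.update_self, prevProj_update c le_rfl]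

theorem integral_defectPart :
    ∫ c, defectPart T J c ∂(columnLaw n)
      = ∑ j ∈ J, (T.card / n : ℝ) * ∫ c, defectSq j c ∂(columnLaw n) := by
  simp_rw [defectPart]
  rw [HasMoments.integral_sum _ fun j _ =>
    (hasMoments_defectSq j).mul (hasMoments_partialTrace _ _)]
  refine Finset.sum_congr rfl fun j _ => ?_
  rw [integral_mul_partialTrace j.pos (hasMoments_defectSq j) (defectSq_map j)]
  simp

/-- The cross term has mean zero, since the projection of a column to the span of the preceding ones
is symmetric given the orthogonal component. -/
theorem integral_distSq :
    ∫ c, distSq T J c ∂(columnLaw n)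
      = ∫ c, projPart T J c ∂(columnLaw n) + ∫ c, defectPart T J c ∂(columnLaw n) := by
  have hi : ∀ j a : Fin n, HasMoments (fun c : Fin n → EuclideanSpace ℝ (Fin n) =>
      ((√(n : ℝ) - ‖gramSchmidt ℝ c j‖) * gramSchmidtNormed ℝ c j a) * prevProj c j (c j) a) (columnLaw n) := fun j a =>
    (((hasMoments_const _).sub (hasMoments_norm_gramSchmidt j)).mul
      (hasMoments_gramSchmidtNormed_apply j a)).mul (hasMoments_prevProj_apply j a)
  have hz : ∀ j a : Fin n, ∫ c : Fin n → EuclideanSpace ℝ (Fin n),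
      ((√(n : ℝ) - ‖gramSchmidt ℝ c j‖) * gramSchmidtNormed ℝ c j a) * prevProj c j (c j) a ∂(columnLaw n) = 0 := by
    intro j a
    refine (integral_columnLaw_eq j (hi j a).integrable (G := fun _ => 0) fun c hc => ?_).trans
      (integral_zero _ _)
    rw [← integral_comp_sub_prevProj_mul_prevProj hc j a
      (fun w => (√(n : ℝ) - ‖w‖) * (‖w‖⁻¹ • w) a)]
    simp only [gramSchmidtNormed, gramSchmidt_eq_sub_prevProj, Function.update_self,
      prevProj_update c le_rfl, RCLike.ofReal_real_eq_id, id_eq]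
  simp_rw [distSq_eq]
  rw [((hasMoments_projPart T J).add (hasMoments_defectPart T J)).integral_sub
    ((HasMoments.sum _ fun j _ => HasMoments.sum _ fun a _ => hi j a).const_mul 2),
    (hasMoments_projPart T J).integral_add (hasMoments_defectPart T J), integral_const_mul,
    HasMoments.integral_sum _ fun j _ => HasMoments.sum _ fun a _ => hi j a,
    Finset.sum_eq_zero fun j _ => ?_, mul_zero, sub_zero]
  rw [HasMoments.integral_sum _ fun a _ => hi j a]
  exact Finset.sum_eq_zero fun a _ => hz j a

end Distance

/-! ### Second moments of the two parts -/

section SecondMomentBounds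

variable {n : ℕ}

theorem hasMoments_sum_gramEntry_sq (s T : Finset (Fin n)) :
    HasMoments (fun c => ∑ a ∈ T, ∑ b ∈ T, gramEntry s c a b ^ 2) (columnLaw n) :=
  HasMoments.sum _ fun _ _ => HasMoments.sum _ fun _ _ => (hasMoments_gramEntry s _ _).pow 2

theorem partialTrace_update {i j : Fin n} (hij : i ≤ j) (T : Finset (Fin n))
    (c : Fin n → EuclideanSpace ℝ (Fin n)) (y : EuclideanSpace ℝ (Fin n)) :
    partialTrace (Finset.Iio i) T (Function.update c j y) = partialTrace (Finset.Iio i) T c := by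
  refine Finset.sum_congr rfl fun a _ => ?_
  rw [gramEntry_eq, gramEntry_eq]
  refine Finset.sum_congr rfl fun k hk => ?_
  rw [gramSchmidtNormed_update c ((Finset.mem_Iio.1 hk).trans_le hij)]

theorem integral_sum_gramEntry_sq_le (hn : 2 ≤ n) (T : Finset (Fin n)) (j : Fin n) {q : ℝ}
    (hj : (j : ℝ) ≤ q) :
    ∫ c, ∑ a ∈ T, ∑ b ∈ T, gramEntry (Finset.Iio j) c a b ^ 2 ∂(columnLaw n)
      ≤ 3 * T.card * q ^ 2 / n ^ 2 + T.card ^ 2 * q / n ^ 2 := by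
  refine (integral_sum_sum_gramEntry_sq_le hn _ T).trans ?_
  rw [Fin.card_Iio]
  gcongr

theorem integral_blockSq_column_sq_le (hn : 2 ≤ n) (T : Finset (Fin n)) (j : Fin n) {q : ℝ}
    (hq : 1 ≤ q) (hj : (j : ℝ) ≤ q) :
    ∫ c, blockSq T c j (c j) ^ 2 ∂(columnLaw n) ≤ 11 * T.card ^ 2 * q ^ 2 / n ^ 2 := by
  have ht := (hasMoments_partialTrace (Finset.Iio j) T).pow 2
  have hg := hasMoments_sum_gramEntry_sq (Finset.Iio j) T
  rw [integral_columnLaw_eq j ((hasMoments_blockSq T j).pow 2).integrable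
    (G := fun c => partialTrace (Finset.Iio j) T c ^ 2
        + 2 * ∑ a ∈ T, ∑ b ∈ T, gramEntry (Finset.Iio j) c a b ^ 2) ?_,
    ht.integral_add (hg.const_mul 2), integral_const_mul]
  · have h1 := integral_mul_partialTrace_sq_le hn (hasMoments_const (1 : ℝ))
      (fun _ => zero_le_one) (fun _ _ => rfl) (Finset.Iio j) T
    have h2 := integral_sum_gramEntry_sq_le hn T j hj
    simp only [one_mul, integral_const, probReal_univ, smul_eq_mul, mul_one, Fin.card_Iio] at h1
    have h3 : (3 * T.card ^ 2 * j ^ 2 / n ^ 2 : ℝ) ≤ 3 * T.card ^ 2 * q ^ 2 / n ^ 2 := by gcongr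
    have h4 : (3 * T.card * q ^ 2 / n ^ 2 : ℝ) ≤ 3 * T.card ^ 2 * q ^ 2 / n ^ 2 := by
      have : (T.card : ℝ) ≤ T.card ^ 2 := by
        exact_mod_cast Nat.le_self_pow two_ne_zero T.card
      gcongr
    have h5 : (T.card ^ 2 * q / n ^ 2 : ℝ) ≤ T.card ^ 2 * q ^ 2 / n ^ 2 := by
      gcongr
      nlinarith
    calc _ ≤ 3 * T.card ^ 2 * q ^ 2 / n ^ 2
          + 2 * (3 * T.card ^ 2 * q ^ 2 / n ^ 2 + T.card ^ 2 * q ^ 2 / n ^ 2 : ℝ) := by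
          linarith
      _ = _ := by ring
  · intro c hc
    rw [← integral_blockSq_sq hc]
    simp only [blockSq, Function.update_self, prevProj_update c le_rfl]

theorem integral_projPart_sq_le (hn : 2 ≤ n) (T J : Finset (Fin n))
    (hJ : ∀ j ∈ J, (j : ℕ) < J.card) :
    ∫ c, projPart T J c ^ 2 ∂(columnLaw n) ≤ 11 * (T.card * J.card ^ 2 / n : ℝ) ^ 2 := by
  have hi : ∀ j, HasMoments (fun c => blockSq T c j (c j) ^ 2) (columnLaw n) :=
    fun j => (hasMoments_blockSq T j).pow 2
  calc ∫ c, projPart T J c ^ 2 ∂(columnLaw n)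
      ≤ ∫ c, J.card * ∑ j ∈ J, blockSq T c j (c j) ^ 2 ∂(columnLaw n) := by
        refine integral_mono ((hasMoments_projPart T J).pow 2).integrable
          ((HasMoments.sum _ fun j _ => hi j).const_mul _).integrable fun c => ?_
        exact sq_sum_le_card_mul_sum_sq
    _ = J.card * ∑ j ∈ J, ∫ c, blockSq T c j (c j) ^ 2 ∂(columnLaw n) := by
        rw [integral_const_mul, HasMoments.integral_sum _ fun j _ => hi j]
    _ ≤ J.card * ∑ j ∈ J, (11 * T.card ^ 2 * J.card ^ 2 / n ^ 2 : ℝ) := by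
        refine mul_le_mul_of_nonneg_left (Finset.sum_le_sum fun j hj => ?_) (Nat.cast_nonneg _)
        refine integral_blockSq_column_sq_le hn T j ?_ ?_
        · exact_mod_cast Finset.card_pos.2 ⟨j, hj⟩
        · exact_mod_cast (hJ j hj).le
    _ = _ := by
        rw [Finset.sum_const, nsmul_eq_mul]; ring

/-- Each `defectSq j` is rotation invariant, so it can serve as a weight in the second moment of the
partial trace. -/
theorem integral_defectPart_sq_le (hn : 2 ≤ n) (T J : Finset (Fin n))
    (hJ : ∀ j ∈ J, (j : ℕ) < J.card) :
    ∫ c, defectPart T J c ^ 2 ∂(columnLaw n)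
      ≤ 24 * ((J.card ^ 2 / n : ℝ) ^ 2 + 60) * (T.card * J.card / n : ℝ) ^ 2 := by
  have hi : ∀ j, HasMoments (fun c => defectSq j c ^ 2 * partialTrace {j} T c ^ 2) (columnLaw n) :=
    fun j => ((hasMoments_defectSq j).pow 2).mul ((hasMoments_partialTrace _ _).pow 2)
  calc ∫ c, defectPart T J c ^ 2 ∂(columnLaw n)
      ≤ ∫ c, J.card * ∑ j ∈ J, defectSq j c ^ 2 * partialTrace {j} T c ^ 2 ∂(columnLaw n) := by
        refine integral_mono ((hasMoments_defectPart T J).pow 2).integrable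
          ((HasMoments.sum _ fun j _ => hi j).const_mul _).integrable fun c => ?_
        simp only [← mul_pow]
        exact sq_sum_le_card_mul_sum_sq
    _ = J.card * ∑ j ∈ J, ∫ c, defectSq j c ^ 2 * partialTrace {j} T c ^ 2 ∂(columnLaw n) := by
        rw [integral_const_mul, HasMoments.integral_sum _ fun j _ => hi j]
    _ ≤ J.card * ∑ j ∈ J, (3 * T.card ^ 2 / n ^ 2 * (8 * ((J.card ^ 2 / n) ^ 2 + 60)) : ℝ) := by
        refine mul_le_mul_of_nonneg_left (Finset.sum_le_sum fun j hj => ?_) (Nat.cast_nonneg _)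
        have h := integral_mul_partialTrace_sq_le hn ((hasMoments_defectSq j).pow 2)
          (fun c => sq_nonneg _) (fun L c => by simp only [defectSq_map]) {j} T
        rw [Finset.card_singleton, Nat.cast_one, one_pow, mul_one] at h
        refine h.trans (mul_le_mul_of_nonneg_left ?_ (by positivity))
        refine (integral_defectSq_sq_le j).trans ?_
        have : (j : ℝ) ≤ J.card := by exact_mod_cast (hJ j hj).le
        gcongr
    _ = _ := by
        rw [Finset.sum_const, nsmul_eq_mul]; ring

/-- The deviations of `blockSq` from its conditional mean are martingale differences, hence
orthogonal. -/
theorem integral_mul_blockSq_sub_partialTrace (T : Finset (Fin n)) {i j : Fin n} (hij : i < j) :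
    ∫ c, (blockSq T c i (c i) - partialTrace (Finset.Iio i) T c) *
      (blockSq T c j (c j) - partialTrace (Finset.Iio j) T c) ∂(columnLaw n) = 0 := by
  have hi : ∀ k, HasMoments (fun c => blockSq T c k (c k) - partialTrace (Finset.Iio k) T c)
      (columnLaw n) := fun k => (hasMoments_blockSq T k).sub (hasMoments_partialTrace _ T)
  refine (integral_columnLaw_eq j ((hi i).mul (hi j)).integrable (G := fun _ => 0)
    fun c hc => ?_).trans (integral_zero _ _)
  simp only [partialTrace_update hij.le, partialTrace_update le_rfl, Function.update_of_ne hij.ne,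
    Function.update_self, blockSq, prevProj_update c hij.le, prevProj_update c le_rfl]
  rw [integral_const_mul]
  have h : ∫ y, (blockSq T c j y - partialTrace (Finset.Iio j) T c)
      ∂(stdGaussian (EuclideanSpace ℝ (Fin n))) = 0 := by
    rw [(hasMoments_blockSq_stdGaussian T c j).integral_sub (hasMoments_const _),
      integral_blockSq hc]
    simp
  simp only [blockSq] at h
  rw [h, mul_zero]

theorem integral_blockSq_sub_partialTrace_sq (T : Finset (Fin n)) (j : Fin n) :
    ∫ c, (blockSq T c j (c j) - partialTrace (Finset.Iio j) T c) ^ 2 ∂(columnLaw n)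
      = 2 * ∫ c, ∑ a ∈ T, ∑ b ∈ T, gramEntry (Finset.Iio j) c a b ^ 2 ∂(columnLaw n) := by
  have hi := ((hasMoments_blockSq T j).sub (hasMoments_partialTrace (Finset.Iio j) T)).pow 2
  rw [← integral_const_mul]
  refine integral_columnLaw_eq j hi.integrable fun c hc => ?_
  have h1 := integral_blockSq hc T j
  have h2 := integral_blockSq_sq hc T j
  have hm := hasMoments_blockSq_stdGaussian T c j
  have e : ∀ y, blockSq T (Function.update c j y) j (Function.update c j y j) = blockSq T c j y :=
    fun y => by simp only [blockSq, Function.update_self, prevProj_update c le_rfl]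
  simp_rw [e, partialTrace_update le_rfl]
  set t := partialTrace (Finset.Iio j) T c
  simp_rw [show ∀ x : ℝ, (x - t) ^ 2 = x ^ 2 - 2 * t * x + t ^ 2 by intro x; ring]
  rw [((hm.pow 2).sub (hm.const_mul _)).integral_add (hasMoments_const _),
    (hm.pow 2).integral_sub (hm.const_mul _), integral_const_mul, h1, h2]
  simp only [integral_const, probReal_univ, smul_eq_mul, one_mul]
  ring

/-- The variance of `projPart`. The deviation from the mean is the sum of a martingale, whose
differences are `blockSq - partialTrace`, and of the deviations of the partial traces. -/
theorem integral_projPart_sub_sq_le (hn : 2 ≤ n) (T J : Finset (Fin n))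
    (hJ : ∀ j ∈ J, (j : ℕ) < J.card) :
    ∫ c, (projPart T J c - ∑ j ∈ J, (T.card * j / n : ℝ)) ^ 2 ∂(columnLaw n)
      ≤ 16 * T.card * J.card ^ 3 / n ^ 2 + 4 * T.card ^ 2 * J.card ^ 2 / n ^ 2 := by
  set D : Fin n → (Fin n → EuclideanSpace ℝ (Fin n)) → ℝ :=
    fun j c => blockSq T c j (c j) - partialTrace (Finset.Iio j) T c with hD
  set U : Fin n → (Fin n → EuclideanSpace ℝ (Fin n)) → ℝ :=
    fun j c => partialTrace (Finset.Iio j) T c - T.card * j / n with hU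
  have hDm : ∀ j, HasMoments (D j) (columnLaw n) :=
    fun j => (hasMoments_blockSq T j).sub (hasMoments_partialTrace _ T)
  have hUm : ∀ j, HasMoments (U j) (columnLaw n) :=
    fun j => (hasMoments_partialTrace _ T).sub (hasMoments_const _)
  have hj : ∀ j ∈ J, (j : ℝ) ≤ J.card := fun j hj => by exact_mod_cast (hJ j hj).le
  have hDsum : ∫ c, (∑ j ∈ J, D j c) ^ 2 ∂(columnLaw n)
      ≤ J.card * (2 * (3 * T.card * J.card ^ 2 / n ^ 2 + T.card ^ 2 * J.card / n ^ 2)) := by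
    simp_rw [sq (∑ j ∈ J, _), Finset.sum_mul_sum]
    rw [HasMoments.integral_sum _ fun i _ => HasMoments.sum _ fun j _ => (hDm i).mul (hDm j)]
    rw [← nsmul_eq_mul]
    refine Finset.sum_le_card_nsmul _ _ _ fun i hi => ?_
    rw [HasMoments.integral_sum _ fun j _ => (hDm i).mul (hDm j),
      Finset.sum_eq_single_of_mem i hi]
    · simp_rw [← sq]
      rw [integral_blockSq_sub_partialTrace_sq]
      exact mul_le_mul_of_nonneg_left (integral_sum_gramEntry_sq_le hn T i (hj i hi)) (by norm_num)
    · intro j _ hji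
      rcases lt_or_gt_of_ne hji with h | h
      · simp_rw [mul_comm (D i _)]
        exact integral_mul_blockSq_sub_partialTrace T h
      · exact integral_mul_blockSq_sub_partialTrace T h
  have hUsum : ∫ c, (∑ j ∈ J, U j c) ^ 2 ∂(columnLaw n)
      ≤ J.card * (J.card * (2 * T.card * J.card / n ^ 2)) := by
    calc ∫ c, (∑ j ∈ J, U j c) ^ 2 ∂(columnLaw n)
        ≤ ∫ c, J.card * ∑ j ∈ J, U j c ^ 2 ∂(columnLaw n) := by
          refine integral_mono ((HasMoments.sum _ fun j _ => hUm j).pow 2).integrable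
            ((HasMoments.sum _ fun j _ => (hUm j).pow 2).const_mul _).integrable fun c => ?_
          exact sq_sum_le_card_mul_sum_sq
      _ = J.card * ∑ j ∈ J, ∫ c, U j c ^ 2 ∂(columnLaw n) := by
          rw [integral_const_mul, HasMoments.integral_sum _ fun j _ => (hUm j).pow 2]
      _ ≤ J.card * (J.card * (2 * T.card * J.card / n ^ 2)) := by
          refine mul_le_mul_of_nonneg_left ?_ (Nat.cast_nonneg _)
          rw [← nsmul_eq_mul]
          refine Finset.sum_le_card_nsmul _ _ _ fun j hjJ => ?_
          have h := integral_partialTrace_sub_sq_le hn (Finset.Iio j) T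
          rw [Fin.card_Iio] at h
          refine h.trans ?_
          have := hj j hjJ
          gcongr
  have hDs := HasMoments.sum J fun j _ => hDm j
  have hUs := HasMoments.sum J fun j _ => hUm j
  calc ∫ c, (projPart T J c - ∑ j ∈ J, (T.card * j / n : ℝ)) ^ 2 ∂(columnLaw n)
      ≤ ∫ c, (2 * (∑ j ∈ J, D j c) ^ 2 + 2 * (∑ j ∈ J, U j c) ^ 2) ∂(columnLaw n) := by
        refine integral_mono
          (((hasMoments_projPart T J).sub (hasMoments_const _)).pow 2).integrable
          (((hDs.pow 2).const_mul 2).add ((hUs.pow 2).const_mul 2)).integrable fun c => ?_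
        have e : projPart T J c - ∑ j ∈ J, (T.card * j / n : ℝ)
            = ∑ j ∈ J, D j c + ∑ j ∈ J, U j c := by
          simp only [hD, hU, projPart, Finset.sum_sub_distrib]; ring
        simp only [e]
        nlinarith [sq_nonneg (∑ j ∈ J, D j c - ∑ j ∈ J, U j c)]
    _ = 2 * ∫ c, (∑ j ∈ J, D j c) ^ 2 ∂(columnLaw n)
        + 2 * ∫ c, (∑ j ∈ J, U j c) ^ 2 ∂(columnLaw n) := by
        rw [((hDs.pow 2).const_mul 2).integral_add ((hUs.pow 2).const_mul 2), integral_const_mul,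
          integral_const_mul]
    _ ≤ 2 * (J.card * (2 * (3 * T.card * J.card ^ 2 / n ^ 2 + T.card ^ 2 * J.card / n ^ 2)))
        + 2 * (J.card * (J.card * (2 * T.card * J.card / n ^ 2))) := by gcongr
    _ = _ := by ring

/-! ### Bounds in terms of the block sizes -/

variable {p q : ℕ}

/-- The set of the first `q` indices. -/
def firstIndices (hq : q ≤ n) : Finset (Fin n) := Finset.univ.map (Fin.castLEEmb hq)

theorem card_firstIndices (hq : q ≤ n) : (firstIndices hq).card = q := by
  simp [firstIndices]

theorem lt_of_mem_firstIndices {hq : q ≤ n} {j : Fin n} (hj : j ∈ firstIndices hq) :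
    (j : ℕ) < q := by
  obtain ⟨i, -, rfl⟩ := Finset.mem_map.1 hj
  exact i.2

theorem sum_firstIndices (hq : q ≤ n) : ∑ j ∈ firstIndices hq, (j : ℝ) = q * (q - 1) / 2 := by
  rw [firstIndices, Finset.sum_map]
  simp only [Fin.castLEEmb_apply, Fin.val_castLE]
  rw [Fin.sum_univ_eq_sum_range (fun i => (i : ℝ)) q]
  have := Finset.sum_range_id_mul_two q
  have h2 : ((∑ i ∈ Finset.range q, i : ℕ) : ℝ) * 2 = q * (q - 1) := by
    rcases Nat.eq_zero_or_pos q with h | h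
    · simp [h]
    · have h1 : ((q - 1 : ℕ) : ℝ) = q - 1 := by rw [Nat.cast_sub h, Nat.cast_one]
      rw [← h1]; exact_mod_cast this
  push_cast at h2
  linarith

theorem integral_projPart_firstIndices (hp : p ≤ n) (hq : q ≤ n) :
    ∫ c, projPart (firstIndices hp) (firstIndices hq) c ∂(columnLaw n)
      = p * q * (q - 1) / (2 * n) := by
  rw [integral_projPart, card_firstIndices, ← Finset.sum_div, ← Finset.mul_sum, sum_firstIndices]
  field_simp

theorem integral_defectPart_firstIndices_le (hp : p ≤ n) (hq : q ≤ n) :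
    ∫ c, defectPart (firstIndices hp) (firstIndices hq) c ∂(columnLaw n)
      ≤ p * q / n * (2 + q ^ 2 / n) := by
  rw [integral_defectPart, card_firstIndices]
  calc ∑ j ∈ firstIndices hq, (p / n : ℝ) * ∫ c, defectSq j c ∂(columnLaw n)
      ≤ (firstIndices hq).card • ((p / n : ℝ) * (2 + q ^ 2 / n)) := by
        refine Finset.sum_le_card_nsmul _ _ _ fun j hj => ?_
        refine mul_le_mul_of_nonneg_left ((integral_defectSq_le j).trans ?_) (by positivity)
        have : (j : ℝ) ≤ q := by exact_mod_cast (lt_of_mem_firstIndices hj).le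
        gcongr
    _ = _ := by rw [card_firstIndices, nsmul_eq_mul]; ring

theorem le_integral_defectPart_firstIndices (hn : 2 ≤ n) (hp : p ≤ n) (hq : q ≤ n) :
    p * q / (2 * n) * (1 - q / n) * (1 - 2 / n)
      ≤ ∫ c, defectPart (firstIndices hp) (firstIndices hq) c ∂(columnLaw n) := by
  rw [integral_defectPart, card_firstIndices]
  have hn' : (2 : ℝ) ≤ n := by exact_mod_cast hn
  have h2 : (0 : ℝ) ≤ 1 - 2 / n := by
    rw [sub_nonneg, div_le_one (by linarith)]; exact hn'
  calc p * q / (2 * n) * (1 - q / n) * (1 - 2 / n)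
      = (firstIndices hq).card • ((p / n : ℝ) * (1 / 2 * (1 - q / n) * (1 - 2 / n))) := by
        rw [card_firstIndices, nsmul_eq_mul]; ring
    _ ≤ ∑ j ∈ firstIndices hq, (p / n : ℝ) * ∫ c, defectSq j c ∂(columnLaw n) := by
        refine Finset.card_nsmul_le_sum _ _ _ fun j hj => ?_
        refine mul_le_mul_of_nonneg_left (le_trans ?_ (le_integral_defectSq j)) (by positivity)
        have : (j : ℝ) ≤ q := by exact_mod_cast (lt_of_mem_firstIndices hj).le
        gcongr

end SecondMomentBounds

/-! ### Tail estimates -/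

section Tail

variable {α : Type*} {_ : MeasurableSpace α} {μ : Measure α} {X : α → ℝ}

theorem measureReal_ge_le_div (hX : HasMoments X μ) (h0 : ∀ x, 0 ≤ X x) {e : ℝ} (he : 0 < e) :
    μ.real {x | e ≤ X x} ≤ (∫ x, X x ∂μ) / e := by
  rw [le_div_iff₀ he, mul_comm]
  exact mul_meas_ge_le_integral_of_nonneg (Eventually.of_forall h0) hX.integrable e

/-- A form of the Paley-Zygmund inequality, with bounds for the first two moments. -/
theorem le_measureReal_ge [IsProbabilityMeasure μ] (hX : HasMoments X μ) (hXm : Measurable X)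
    {e m K : ℝ} (he : 0 ≤ e) (hK : 0 < K) (hem : e < m) (hm : m ≤ ∫ x, X x ∂μ)
    (hXK : ∫ x, X x ^ 2 ∂μ ≤ K) :
    (m - e) ^ 2 / K ≤ μ.real {x | e ≤ X x} := by
  have hA : MeasurableSet {x | e ≤ X x} := measurableSet_le measurable_const hXm
  set A := {x | e ≤ X x} with hAdef
  have hd : 0 < m - e := sub_pos.2 hem
  -- the weight that balances the two terms of the elementary inequality `2ab ≤ r a² + b² / r`
  set r := (m - e) / K with hr
  have hr0 : 0 < r := div_pos hd hK
  have hind : HasMoments (fun x => A.indicator (fun _ => (1 : ℝ)) x) μ :=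
    fun k => (hasMoments_const (1 : ℝ) k).indicator hA
  have h1 : ∫ x, X x ∂μ ≤ ∫ x, (e + (r / 2 * X x ^ 2
      + 1 / (2 * r) * A.indicator (fun _ => (1 : ℝ)) x)) ∂μ := by
    refine integral_mono hX.integrable ((hasMoments_const e).add
      (((hX.pow 2).const_mul _).add (hind.const_mul _))).integrable fun x => ?_
    simp only
    by_cases hx : x ∈ A
    · rw [Set.indicator_of_mem hx]
      have : 0 ≤ (r * X x - 1) ^ 2 / (2 * r) := by positivity
      have e2 : (r * X x - 1) ^ 2 / (2 * r) = r / 2 * X x ^ 2 + 1 / (2 * r) * 1 - X x := by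
        field_simp; ring
      linarith
    · rw [Set.indicator_of_notMem hx]
      have hlt : X x < e := not_le.1 hx
      have : 0 ≤ r / 2 * X x ^ 2 := by positivity
      linarith
  rw [(hasMoments_const e).integral_add (((hX.pow 2).const_mul _).add (hind.const_mul _)),
    ((hX.pow 2).const_mul _).integral_add (hind.const_mul _), integral_const_mul,
    integral_const_mul, integral_indicator_const _ hA] at h1
  simp only [integral_const, probReal_univ, smul_eq_mul, one_mul, mul_one] at h1
  have h2 : m - e ≤ r / 2 * K + 1 / (2 * r) * μ.real A := by
    have : r / 2 * ∫ x, X x ^ 2 ∂μ ≤ r / 2 * K := by gcongr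
    linarith
  have h3 : r / 2 * K = (m - e) / 2 := by rw [hr]; field_simp
  have h4 : 1 / (2 * r) = K / (2 * (m - e)) := by rw [hr]; field_simp
  rw [h3, h4] at h2
  rw [div_le_iff₀ hK]
  have h5 : (m - e) / 2 ≤ K / (2 * (m - e)) * μ.real A := by linarith
  have h6 := mul_le_mul_of_nonneg_left h5 (show 0 ≤ 2 * (m - e) by linarith)
  have h7 : 2 * (m - e) * (K / (2 * (m - e)) * μ.real A) = K * μ.real A := by field_simp
  rw [h7] at h6
  nlinarith

end Tail

/-! ### Bounds in terms of `p * q ^ 2 / n` -/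

section Sizes

variable {n p q : ℕ}

theorem measurable_distSq (T J : Finset (Fin n)) : Measurable (distSq T J) := by
  refine Finset.measurable_sum _ fun j _ => Finset.measurable_sum _ fun a _ => ?_
  have h1 : Measurable fun c : Fin n → EuclideanSpace ℝ (Fin n) => gramSchmidtNormed ℝ c j a :=
    (measurable_pi_apply a).comp ((WithLp.measurable_ofLp 2 _).comp
      (measurable_gramSchmidtNormed j))
  have h2 : Measurable fun c : Fin n → EuclideanSpace ℝ (Fin n) => c j a :=
    (measurable_pi_apply a).comp ((WithLp.measurable_ofLp 2 _).comp (measurable_pi_apply j))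
  exact ((h1.const_mul _).sub h2).pow_const 2

theorem hasMoments_distSq (T J : Finset (Fin n)) : HasMoments (distSq T J) (columnLaw n) :=
  (((hasMoments_projPart T J).add (hasMoments_defectPart T J)).const_mul 2).mono
    (measurable_distSq T J).aestronglyMeasurable (Eventually.of_forall fun c => by
      rw [abs_of_nonneg (distSq_nonneg T J c)]; exact distSq_le T J c)

/-- The bounds for the auxiliary ratios of block sizes in terms of `p * q ^ 2 / n`. -/
theorem ratio_bounds (hn : 1 ≤ n) (hp1 : 1 ≤ p) (hq1 : 1 ≤ q) :
    (p * q / n : ℝ) ≤ p * q ^ 2 / n ∧ (q ^ 2 / n : ℝ) ≤ p * q ^ 2 / n := by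
  have hp' : (1 : ℝ) ≤ p := by exact_mod_cast hp1
  have hq' : (1 : ℝ) ≤ q := by exact_mod_cast hq1
  constructor
  · gcongr; nlinarith
  · gcongr; nlinarith [sq_nonneg (q : ℝ)]

theorem integral_defectPart_le_ratio (hn : 1 ≤ n) (hp1 : 1 ≤ p) (hq1 : 1 ≤ q) (hp : p ≤ n)
    (hq : q ≤ n) :
    ∫ c, defectPart (firstIndices hp) (firstIndices hq) c ∂(columnLaw n)
      ≤ (p * q ^ 2 / n) / q * (2 + p * q ^ 2 / n : ℝ) := by
  refine (integral_defectPart_firstIndices_le hp hq).trans ?_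
  have hq' : (0 : ℝ) < q := by exact_mod_cast hq1
  have e : (p * q ^ 2 / n : ℝ) / q = p * q / n := by field_simp
  rw [e]
  have := (ratio_bounds hn hp1 hq1).2
  gcongr

theorem integral_distSq_le_ratio (hn : 1 ≤ n) (hp1 : 1 ≤ p) (hq1 : 1 ≤ q) (hp : p ≤ n)
    (hq : q ≤ n) :
    ∫ c, distSq (firstIndices hp) (firstIndices hq) c ∂(columnLaw n)
      ≤ p * q ^ 2 / n + (p * q ^ 2 / n) * (2 + p * q ^ 2 / n : ℝ) := by
  rw [integral_distSq, integral_projPart_firstIndices]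
  have hq' : (1 : ℝ) ≤ q := by exact_mod_cast hq1
  have hn' : (0 : ℝ) < n := by exact_mod_cast hn
  have h := integral_defectPart_le_ratio hn hp1 hq1 hp hq
  refine add_le_add ?_ (h.trans ?_)
  · rw [div_le_div_iff₀ (by positivity) hn']
    have : (0 : ℝ) ≤ p * q * n := by positivity
    nlinarith
  · exact mul_le_mul_of_nonneg_right (div_le_self (by positivity) hq') (by positivity)

/-- The contribution `p * q * (q - 1) / (2 * n)` of `projPart` and the contribution of order
`p * q / (2 * n)` of `defectPart` add up to `p * q ^ 2 / (2 * n)`, up to lower order. -/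
theorem le_integral_distSq_ratio (hn : 2 ≤ n) (hq1 : 1 ≤ q) (hp : p ≤ n) (hq : q ≤ n) :
    (p * q ^ 2 / n / 2 - 3 / 2 * (p * q ^ 2 / n) * (1 / n) : ℝ)
      ≤ ∫ c, distSq (firstIndices hp) (firstIndices hq) c ∂(columnLaw n) := by
  rw [integral_distSq, integral_projPart_firstIndices]
  have hq' : (1 : ℝ) ≤ q := by exact_mod_cast hq1
  have hn' : (0 : ℝ) < n := by exact_mod_cast (by omega : 0 < n)
  refine le_trans ?_ (add_le_add le_rfl (le_integral_defectPart_firstIndices hn hp hq))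
  have e : (p * q * (q - 1) / (2 * n) + p * q / (2 * n) * (1 - q / n) * (1 - 2 / n) : ℝ)
      - (p * q ^ 2 / n / 2 - 3 / 2 * (p * q ^ 2 / n) * (1 / n))
      = p * q * (2 * (q - 1)) / (2 * n ^ 2) + p * q ^ 2 / n ^ 3 := by
    field_simp; ring
  have h1 : (0 : ℝ) ≤ p * q * (2 * (q - 1)) / (2 * n ^ 2) := by
    have : (0 : ℝ) ≤ q - 1 := by linarith
    positivity
  have h2 : (0 : ℝ) ≤ p * q ^ 2 / n ^ 3 := by positivity
  linarith

theorem integral_distSq_sq_le_ratio (hn : 2 ≤ n) (hp1 : 1 ≤ p) (hq1 : 1 ≤ q) (hp : p ≤ n)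
    (hq : q ≤ n) :
    ∫ c, distSq (firstIndices hp) (firstIndices hq) c ^ 2 ∂(columnLaw n)
      ≤ 8 * (11 * (p * q ^ 2 / n : ℝ) ^ 2
        + 24 * ((p * q ^ 2 / n) ^ 2 + 60) * (p * q ^ 2 / n) ^ 2) := by
  set T := firstIndices hp
  set J := firstIndices hq
  have hT : T.card = p := card_firstIndices hp
  have hJ : J.card = q := card_firstIndices hq
  have hlt : ∀ j ∈ J, (j : ℕ) < J.card := fun j hj => by
    rw [hJ]; exact lt_of_mem_firstIndices hj
  have hS := (hasMoments_projPart T J).pow 2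
  have hD := (hasMoments_defectPart T J).pow 2
  have h1 := integral_projPart_sq_le hn T J hlt
  have h2 := integral_defectPart_sq_le hn T J hlt
  rw [hT, hJ] at h1 h2
  obtain ⟨r1, r2⟩ := ratio_bounds (by omega : 1 ≤ n) hp1 hq1
  calc ∫ c, distSq T J c ^ 2 ∂(columnLaw n)
      ≤ ∫ c, 8 * (projPart T J c ^ 2 + defectPart T J c ^ 2) ∂(columnLaw n) := by
        refine integral_mono ((hasMoments_distSq T J).pow 2).integrable
          ((hS.add hD).const_mul 8).integrable fun c => ?_
        have h3 := pow_le_pow_left₀ (distSq_nonneg T J c) (distSq_le T J c) 2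
        simp only
        nlinarith [sq_nonneg (projPart T J c - defectPart T J c)]
    _ = 8 * (∫ c, projPart T J c ^ 2 ∂(columnLaw n)
        + ∫ c, defectPart T J c ^ 2 ∂(columnLaw n)) := by
        rw [integral_const_mul, hS.integral_add hD]
    _ ≤ 8 * (11 * (p * q ^ 2 / n : ℝ) ^ 2
        + 24 * ((q ^ 2 / n) ^ 2 + 60) * (p * q / n) ^ 2) := by gcongr
    _ ≤ _ := by gcongr

theorem integral_projPart_sub_sq_le_ratio (hn : 2 ≤ n) (hp1 : 1 ≤ p) (hq1 : 1 ≤ q) (hp : p ≤ n)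
    (hq : q ≤ n) (τ : ℝ) :
    ∫ c, (projPart (firstIndices hp) (firstIndices hq) c - τ) ^ 2 ∂(columnLaw n)
      ≤ 40 * (p * q ^ 2 / n : ℝ) ^ 2 * (1 / q)
        + 2 * (p * q ^ 2 / n * (1 - 1 / q) / 2 - τ) ^ 2 := by
  set T := firstIndices hp
  set J := firstIndices hq
  have hT : T.card = p := card_firstIndices hp
  have hJ : J.card = q := card_firstIndices hq
  have hlt : ∀ j ∈ J, (j : ℕ) < J.card := fun j hj => by
    rw [hJ]; exact lt_of_mem_firstIndices hj
  have hV := integral_projPart_sub_sq_le hn T J hlt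
  rw [← integral_projPart, integral_projPart_firstIndices, hT, hJ] at hV
  have hq0 : (1 : ℝ) ≤ q := by exact_mod_cast hq1
  have hp0 : (1 : ℝ) ≤ p := by exact_mod_cast hp1
  have hn0 : (0 : ℝ) < n := by exact_mod_cast (by omega : 0 < n)
  set m : ℝ := p * q * (q - 1) / (2 * n) with hm
  have hme : (p * q ^ 2 / n * (1 - 1 / q) / 2 : ℝ) = m := by
    rw [hm]; field_simp
  have hS := hasMoments_projPart T J
  have hSm := (hS.sub (hasMoments_const m)).pow 2
  calc ∫ c, (projPart T J c - τ) ^ 2 ∂(columnLaw n)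
      ≤ ∫ c, (2 * (projPart T J c - m) ^ 2 + 2 * (m - τ) ^ 2) ∂(columnLaw n) := by
        refine integral_mono ((hS.sub (hasMoments_const τ)).pow 2).integrable
          ((hSm.const_mul 2).add (hasMoments_const _)).integrable fun c => ?_
        simp only
        nlinarith [sq_nonneg ((projPart T J c - m) - (m - τ))]
    _ = 2 * ∫ c, (projPart T J c - m) ^ 2 ∂(columnLaw n) + 2 * (m - τ) ^ 2 := by
        rw [(hSm.const_mul 2).integral_add (hasMoments_const _), integral_const_mul]
        simp
    _ ≤ 2 * (16 * p * q ^ 3 / n ^ 2 + 4 * p ^ 2 * q ^ 2 / n ^ 2) + 2 * (m - τ) ^ 2 := by gcongr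
    _ ≤ _ := by
        rw [hme]
        have e : 40 * (p * q ^ 2 / n : ℝ) ^ 2 * (1 / q) = 40 * (p ^ 2 * q ^ 3) / n ^ 2 := by
          field_simp
        have e2 : (2 * (16 * p * q ^ 3 / n ^ 2 + 4 * p ^ 2 * q ^ 2 / n ^ 2) : ℝ)
            = (32 * (p * q ^ 3) + 8 * (p ^ 2 * q ^ 2)) / n ^ 2 := by ring
        rw [e, e2]
        have h1 : (p * q ^ 3 : ℝ) ≤ p ^ 2 * q ^ 3 := by gcongr; nlinarith
        have h2 : (p ^ 2 * q ^ 2 : ℝ) ≤ p ^ 2 * q ^ 3 := by gcongr; exact (by norm_num : 2 ≤ 3)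
        gcongr
        linarith

end Sizes

/-! ### Haar measure on the orthogonal group -/

section Haar

variable {n : ℕ}

instance : BorelSpace (Matrix (Fin n) (Fin n) ℝ) :=
  inferInstanceAs (BorelSpace (Fin n → Fin n → ℝ))

instance : CompactSpace (Matrix.orthogonalGroup (Fin n) ℝ) := by
  refine isCompact_iff_compactSpace
    (s := (Matrix.orthogonalGroup (Fin n) ℝ : Set (Matrix (Fin n) (Fin n) ℝ))).1 ?_
  have hbox : IsCompact (Set.univ.pi fun _ : Fin n => Set.univ.pi fun _ : Fin n =>
      Set.Icc (-1 : ℝ) 1) := isCompact_univ_pi fun _ => isCompact_univ_pi fun _ => isCompact_Icc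
  refine IsCompact.of_isClosed_subset hbox
    (isClosed_unitary (R := Matrix (Fin n) (Fin n) ℝ)) fun A hA => ?_
  refine Set.mem_univ_pi.2 fun i => Set.mem_univ_pi.2 fun j => ?_
  have h := entry_norm_bound_of_unitary (𝕜 := ℝ) hA i j
  exact abs_le.1 h

/-- Multiplication by an orthogonal matrix as an isometry. -/
theorem exists_isometry_of_orthogonal (g : Matrix.orthogonalGroup (Fin n) ℝ) :
    ∃ L : EuclideanSpace ℝ (Fin n) ≃ₗᵢ[ℝ] EuclideanSpace ℝ (Fin n),
      ∀ y i, L y i = ∑ k, g.1 i k * y k := by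
  let f : EuclideanSpace ℝ (Fin n) →ₗ[ℝ] EuclideanSpace ℝ (Fin n) := Matrix.toEuclideanLin g.1
  have hf : ∀ y, ‖f y‖ = ‖y‖ := by
    intro y
    have hg : g.1.transpose * g.1 = 1 := (Matrix.mem_orthogonalGroup_iff' _ _).1 g.2
    have h1 : ∀ v : EuclideanSpace ℝ (Fin n), ‖v‖ ^ 2 = v.ofLp ⬝ᵥ v.ofLp := by
      intro v
      rw [EuclideanSpace.real_norm_sq_eq, dotProduct]
      exact Finset.sum_congr rfl fun i _ => sq _
    have : ‖f y‖ ^ 2 = ‖y‖ ^ 2 := by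
      rw [h1, h1]
      change (g.1.mulVec y.ofLp) ⬝ᵥ (g.1.mulVec y.ofLp) = _
      rw [Matrix.dotProduct_mulVec, ← Matrix.mulVec_transpose, Matrix.mulVec_mulVec, hg,
        Matrix.one_mulVec]
    exact (pow_left_inj₀ (norm_nonneg _) (norm_nonneg _) two_ne_zero).1 this
  exact ⟨LinearIsometry.toLinearIsometryEquiv ⟨f, hf⟩ rfl, fun y i => rfl⟩

/-- The matrix whose columns are the normalized Gram-Schmidt vectors of `c`. -/
noncomputable def orthoMatrix (c : Fin n → EuclideanSpace ℝ (Fin n)) :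
    Matrix (Fin n) (Fin n) ℝ :=
  Matrix.of fun i j => gramSchmidtNormed ℝ c j i

theorem measurable_orthoMatrix :
    Measurable (orthoMatrix : (Fin n → EuclideanSpace ℝ (Fin n)) → Matrix (Fin n) (Fin n) ℝ) :=
  measurable_pi_iff.2 fun i => measurable_pi_iff.2 fun j =>
    (measurable_pi_apply i).comp ((WithLp.measurable_ofLp 2 _).comp
      (measurable_gramSchmidtNormed j))

theorem orthoMatrix_mem {c : Fin n → EuclideanSpace ℝ (Fin n)} (hc : NonDegenerate c) :
    orthoMatrix c ∈ Matrix.orthogonalGroup (Fin n) ℝ := by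
  rw [Matrix.mem_orthogonalGroup_iff']
  ext i j
  have h := orthonormal_iff_ite.1 hc.orthonormal i j
  rw [PiLp.inner_apply] at h
  change ∑ k, gramSchmidtNormed ℝ c i k * gramSchmidtNormed ℝ c j k = _
  rw [Matrix.one_apply, ← h]
  exact Finset.sum_congr rfl fun k _ => by simp [mul_comm]

theorem measurableSet_nonDegenerate :
    MeasurableSet {c : Fin n → EuclideanSpace ℝ (Fin n) | NonDegenerate c} := by
  simp only [NonDegenerate, Set.ofPred_forall]
  exact MeasurableSet.iInter fun j =>
    (measurable_gramSchmidt j (measurableSet_singleton 0)).compl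

open Classical in
/-- The orthogonal matrix produced by the Gram-Schmidt process, with the value `1` on the null set
where the columns are linearly dependent. -/
noncomputable def orthoGroupElement (c : Fin n → EuclideanSpace ℝ (Fin n)) :
    Matrix.orthogonalGroup (Fin n) ℝ :=
  if hc : NonDegenerate c then ⟨orthoMatrix c, orthoMatrix_mem hc⟩ else 1

theorem orthoGroupElement_val {c : Fin n → EuclideanSpace ℝ (Fin n)} (hc : NonDegenerate c) :
    (orthoGroupElement c).1 = orthoMatrix c := by
  rw [orthoGroupElement, dif_pos hc]

theorem measurable_orthoGroupElement :
    Measurable (orthoGroupElement : (Fin n → EuclideanSpace ℝ (Fin n)) → _) := by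
  classical
  have h : Measurable fun c : Fin n → EuclideanSpace ℝ (Fin n) => (orthoGroupElement c).1 := by
    have e : (fun c : Fin n → EuclideanSpace ℝ (Fin n) => (orthoGroupElement c).1)
        = fun c => if NonDegenerate c then orthoMatrix c else 1 := by
      funext c
      by_cases hc : NonDegenerate c
      · rw [if_pos hc, orthoGroupElement_val hc]
      · rw [if_neg hc, orthoGroupElement, dif_neg hc]; rfl
    rw [e]
    exact Measurable.ite measurableSet_nonDegenerate measurable_orthoMatrix measurable_const
  exact h.subtype_mk

theorem orthoMatrix_map (g : Matrix.orthogonalGroup (Fin n) ℝ)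
    (L : EuclideanSpace ℝ (Fin n) ≃ₗᵢ[ℝ] EuclideanSpace ℝ (Fin n))
    (hL : ∀ y i, L y i = ∑ k, g.1 i k * y k) (c : Fin n → EuclideanSpace ℝ (Fin n)) :
    orthoMatrix (fun i => L (c i)) = g.1 * orthoMatrix c := by
  ext i j
  rw [Matrix.mul_apply]
  change gramSchmidtNormed ℝ (fun i => L (c i)) j i = _
  rw [gramSchmidtNormed_map, hL]
  rfl

/-- On a compact group, a left invariant probability measure is a Haar measure. -/
theorem isHaarOrthogonalLaw_orthoMatrix :
    IsHaarOrthogonalLaw ((columnLaw n).map orthoMatrix) := by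
  have hm := measurable_orthoGroupElement (n := n)
  refine ⟨(columnLaw n).map orthoGroupElement, ?_, Measure.isProbabilityMeasure_map hm.aemeasurable,
    ?_⟩
  · have hprob : IsProbabilityMeasure ((columnLaw n).map orthoGroupElement) :=
      Measure.isProbabilityMeasure_map hm.aemeasurable
    have hinv : ((columnLaw n).map orthoGroupElement).IsMulLeftInvariant := by
      refine ⟨fun g => ?_⟩
      obtain ⟨L, hL⟩ := exists_isometry_of_orthogonal g
      have hR := measurePreserving_rotate (n := n) L
      have hg : Measurable fun x : Matrix.orthogonalGroup (Fin n) ℝ => g * x :=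
        (continuous_const.mul continuous_id).measurable
      conv_rhs => rw [← hR.map_eq]
      rw [Measure.map_map hg hm, Measure.map_map hm hR.measurable]
      refine Measure.map_congr ?_
      filter_upwards [ae_nonDegenerate] with c hc
      have hc' : NonDegenerate fun i => L (c i) := fun j => by
        rw [gramSchmidt_map]
        exact fun h => hc j (by simpa using h)
      refine Subtype.ext ?_
      change g.1 * (orthoGroupElement c).1 = (orthoGroupElement fun i => L (c i)).1
      rw [orthoGroupElement_val hc, orthoGroupElement_val hc', orthoMatrix_map g L hL]
    refine Measure.isHaarMeasure_of_isCompact_nonempty_interior _ Set.univ isCompact_univ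
      (by simp) (by simp) (by simp)
  · rw [Measure.map_map measurable_subtype_coe hm]
    refine Measure.map_congr ?_
    filter_upwards [ae_nonDegenerate] with c hc
    exact (orthoGroupElement_val hc).symm

end Haar

/-! ### The columns of a Gaussian matrix -/

section Transfer

variable {Ω : Type*} [MeasurableSpace Ω] {P : Measure Ω} {n : ℕ}
  {Y : Ω → Matrix (Fin n) (Fin n) ℝ}

theorem IsGaussianMatrix.hasLaw_column [IsProbabilityMeasure P] (hY : IsGaussianMatrix P Y) :
    HasLaw (fun ω => column (Y ω)) (columnLaw n) P := by
  have hentry : ∀ i j, AEMeasurable (fun ω => Y ω i j) P := fun i j => (hY.hasLaw i j).aemeasurable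
  have hcol : ∀ j, AEMeasurable (fun ω => column (Y ω) j) P := fun j =>
    (WithLp.measurable_toLp 2 _).comp_aemeasurable (aemeasurable_pi_lambda _ fun i => hentry i j)
  have hg : ∀ ij : Fin n × Fin n, HasGaussianLaw (fun ω => Y ω ij.1 ij.2) P := fun ij =>
    ⟨by rw [(hY.hasLaw ij.1 ij.2).map_eq]; infer_instance⟩
  -- the columns are jointly Gaussian and uncorrelated
  have hjoint : HasGaussianLaw (fun ω (j i : Fin n) => Y ω i j) P := by
    have h := hY.indep.hasGaussianLaw hg
    let L : (Fin n × Fin n → ℝ) →L[ℝ] (Fin n → Fin n → ℝ) :=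
      ContinuousLinearMap.pi fun j => ContinuousLinearMap.pi fun i =>
        ContinuousLinearMap.proj (i, j)
    exact h.map L
  have hind : iIndepFun (fun (j : Fin n) ω (i : Fin n) => Y ω i j) P := by
    refine HasGaussianLaw.iIndepFun_of_covariance_eval (X := fun j i ω => Y ω i j) hjoint
      fun j j' hjj' i i' => ?_
    have hne : ((i, j) : Fin n × Fin n) ≠ (i', j') := fun h => hjj' (Prod.ext_iff.1 h).2
    exact (hY.indep.indepFun hne).covariance_eq_zero (hg (i, j)).memLp_two (hg (i', j')).memLp_two
  have hlaw : ∀ j, P.map (fun ω => column (Y ω) j) = stdGaussian (EuclideanSpace ℝ (Fin n)) := by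
    intro j
    have h1 : iIndepFun (fun (i : Fin n) ω => Y ω i j) P :=
      hY.indep.precomp (g := fun i : Fin n => (i, j)) fun a b h => (Prod.ext_iff.1 h).1
    have h2 := h1.map_fun_eq_pi_map fun i => hentry i j
    simp_rw [fun i => (hY.hasLaw i j).map_eq] at h2
    rw [← map_pi_eq_stdGaussian, ← h2, AEMeasurable.map_map_of_aemeasurable
      (WithLp.measurable_toLp 2 _).aemeasurable (aemeasurable_pi_lambda _ fun i => hentry i j)]
    rfl
  have hind2 : iIndepFun (fun j ω => column (Y ω) j) P :=
    hind.comp (fun _ => WithLp.toLp 2) fun _ => WithLp.measurable_toLp 2 _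
  refine ⟨aemeasurable_pi_lambda _ hcol, ?_⟩
  rw [hind2.map_fun_eq_pi_map hcol]
  simp_rw [hlaw]
  rfl

theorem blockDist_eq {p q : ℕ} (hp : p ≤ n) (hq : q ≤ n) (A : Matrix (Fin n) (Fin n) ℝ) :
    blockDist hp hq A = √(distSq (firstIndices hp) (firstIndices hq) (column A)) := by
  rw [blockDist, hsNorm, distSq, Finset.sum_comm]
  simp only [firstIndices, Finset.sum_map]
  rfl

theorem IsGaussianMatrix.measure_blockDist [IsProbabilityMeasure P] (hY : IsGaussianMatrix P Y)
    {p q : ℕ} (hp : p ≤ n) (hq : q ≤ n) {s : Set ℝ} (hs : MeasurableSet s) :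
    P {ω | blockDist hp hq (Y ω) ∈ s}
      = columnLaw n {c | √(distSq (firstIndices hp) (firstIndices hq) c) ∈ s} := by
  have h := hY.hasLaw_column
  have hm : MeasurableSet {c : Fin n → EuclideanSpace ℝ (Fin n) |
      √(distSq (firstIndices hp) (firstIndices hq) c) ∈ s} :=
    (measurable_distSq _ _).sqrt hs
  rw [← h.map_eq, Measure.map_apply_of_aemeasurable h.aemeasurable hm]
  simp only [blockDist_eq]
  rfl

end Transfer

/-! ### Convergence of the distance -/

section Limit

variable {n p q : ℕ}

theorem measureReal_dist_ge_le (hn : 1 ≤ n) (hp1 : 1 ≤ p) (hq1 : 1 ≤ q) (hp : p ≤ n) (hq : q ≤ n)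
    {ε : ℝ} (hε : 0 < ε) :
    (columnLaw n).real {c | ε ≤ √(distSq (firstIndices hp) (firstIndices hq) c)}
      ≤ (p * q ^ 2 / n + (p * q ^ 2 / n) * (2 + p * q ^ 2 / n : ℝ)) / ε ^ 2 := by
  have e : {c | ε ≤ √(distSq (firstIndices hp) (firstIndices hq) c)}
      = {c | ε ^ 2 ≤ distSq (firstIndices hp) (firstIndices hq) c} := by
    ext c
    exact Real.le_sqrt' hε
  rw [e]
  refine (measureReal_ge_le_div (hasMoments_distSq _ _) (distSq_nonneg _ _) (by positivity)).trans ?_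
  have := integral_distSq_le_ratio hn hp1 hq1 hp hq
  gcongr

theorem abs_sqrt_sub_sqrt_le {x y : ℝ} (hx : 0 ≤ x) (hy : 0 ≤ y) : |√x - √y| ≤ √|x - y| := by
  refine Real.le_sqrt_of_sq_le ?_
  have h1 : |x - y| = |√x - √y| * (√x + √y) := by
    rw [← abs_of_nonneg (add_nonneg (Real.sqrt_nonneg x) (Real.sqrt_nonneg y)), ← abs_mul]
    congr 1
    linear_combination -Real.sq_sqrt hx + Real.sq_sqrt hy
  rw [h1, sq]
  refine mul_le_mul_of_nonneg_left ?_ (abs_nonneg _)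
  rw [abs_le]
  constructor <;> linarith [Real.sqrt_nonneg x, Real.sqrt_nonneg y]

/-- If the distance is off by `ε`, then either `defectPart` is at least `(ε / 2) ^ 2` or `projPart`
is off by at least `(ε / 2) ^ 2`. -/
theorem measureReal_abs_dist_sub_ge_le (hn : 2 ≤ n) (hp1 : 1 ≤ p) (hq1 : 1 ≤ q) (hp : p ≤ n)
    (hq : q ≤ n) {ε τ : ℝ} (hε : 0 < ε) (hτ : 0 ≤ τ) :
    (columnLaw n).real {c | ε ≤ |√(distSq (firstIndices hp) (firstIndices hq) c) - √τ|}
      ≤ (p * q ^ 2 / n) * (1 / q) * (2 + p * q ^ 2 / n : ℝ) / (ε ^ 2 / 4)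
        + (40 * (p * q ^ 2 / n : ℝ) ^ 2 * (1 / q)
          + 2 * (p * q ^ 2 / n * (1 - 1 / q) / 2 - τ) ^ 2) / (ε ^ 4 / 16) := by
  set T := firstIndices hp
  set J := firstIndices hq
  have hS := ((hasMoments_projPart T J).sub (hasMoments_const τ)).pow 2
  have hsub : {c | ε ≤ |√(distSq T J c) - √τ|}
      ⊆ {c | ε ^ 2 / 4 ≤ defectPart T J c} ∪ {c | ε ^ 4 / 16 ≤ (projPart T J c - τ) ^ 2} := by
    intro c hc
    by_contra hcon
    simp only [Set.mem_union, Set.mem_ofPred_eq, not_or, not_le] at hcon hc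
    obtain ⟨h1, h2⟩ := hcon
    have h3 : √(defectPart T J c) < ε / 2 := by
      rw [Real.sqrt_lt' (by positivity)]
      linarith
    have h4 : √|projPart T J c - τ| < ε / 2 := by
      rw [Real.sqrt_lt' (by positivity)]
      refine lt_of_pow_lt_pow_left₀ 2 (by positivity) ?_
      rw [sq_abs]
      refine h2.trans_le (le_of_eq ?_)
      ring
    have h5 := abs_sqrt_distSq_sub_le T J c
    have h6 := abs_sqrt_sub_sqrt_le (projPart_nonneg T J c) hτ
    have h7 := abs_sub_le (√(distSq T J c)) (√(projPart T J c)) (√τ)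
    linarith
  refine (measureReal_mono hsub).trans ((measureReal_union_le _ _).trans (add_le_add ?_ ?_))
  · refine (measureReal_ge_le_div (hasMoments_defectPart T J) (defectPart_nonneg T J)
      (by positivity)).trans ?_
    have h := integral_defectPart_le_ratio (by omega : 1 ≤ n) hp1 hq1 hp hq
    rw [mul_one_div]
    gcongr
  · refine (measureReal_ge_le_div hS (fun _ => sq_nonneg _) (by positivity)).trans ?_
    have h := integral_projPart_sub_sq_le_ratio hn hp1 hq1 hp hq τ
    gcongr

end Limit

section Main

variable {Ω : Type*} [MeasurableSpace Ω] {P : Measure Ω} [IsProbabilityMeasure P]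
  {Y : (n : ℕ) → Ω → Matrix (Fin n) (Fin n) ℝ}

theorem tendstoInMeasure_of_real_bound {f : ℕ → Ω → ℝ} {a : ℝ}
    (h : ∀ ε : ℝ, 0 < ε → ∃ B : ℕ → ℝ, Tendsto B atTop (𝓝 0) ∧
      ∀ᶠ n in atTop, P.real {ω | ε ≤ |f n ω - a|} ≤ B n) :
    TendstoInMeasure P f atTop fun _ => a := by
  rw [tendstoInMeasure_iff_measureReal_norm]
  intro ε hε
  obtain ⟨B, hB, hle⟩ := h ε hε
  exact tendsto_of_tendsto_of_tendsto_of_le_of_le' tendsto_const_nhds hB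
    (Eventually.of_forall fun n => measureReal_nonneg) hle

theorem measureReal_abs_blockDist_sub (hY : ∀ n, IsGaussianMatrix P (Y n)) {n p q : ℕ}
    (hp : p ≤ n) (hq : q ≤ n) (ε a : ℝ) :
    P.real {ω | ε ≤ |blockDist hp hq (Y n ω) - a|}
      = (columnLaw n).real {c | ε ≤ |√(distSq (firstIndices hp) (firstIndices hq) c) - a|} := by
  have hs : MeasurableSet {x : ℝ | ε ≤ |x - a|} :=
    measurableSet_le measurable_const (by fun_prop)
  exact congrArg ENNReal.toReal ((hY n).measure_blockDist hp hq hs)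

variable {p q : ℕ → ℕ} (hp : ∀ n, p n ≤ n) (hq : ∀ n, q n ≤ n)

theorem tendstoInMeasure_blockDist_zero (hY : ∀ n, IsGaussianMatrix P (Y n))
    (hp1 : ∀ n, 1 ≤ n → 1 ≤ p n) (hq1 : ∀ n, 1 ≤ n → 1 ≤ q n)
    (h : Tendsto (fun n => (p n : ℝ) * (q n : ℝ) ^ 2 / (n : ℝ)) atTop (𝓝 0)) :
    TendstoInMeasure P (fun n ω => blockDist (hp n) (hq n) (Y n ω)) atTop (fun _ => (0 : ℝ)) := by
  refine tendstoInMeasure_of_real_bound fun ε hε =>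
    ⟨fun n => (p n * q n ^ 2 / n + (p n * q n ^ 2 / n) * (2 + p n * q n ^ 2 / n : ℝ)) / ε ^ 2,
      ?_, ?_⟩
  · have := (h.add (h.mul (h.const_add 2))).div_const (ε ^ 2)
    simpa using this
  · filter_upwards [eventually_ge_atTop 1] with n hn
    rw [measureReal_abs_blockDist_sub hY]
    refine le_trans (le_of_eq ?_)
      (measureReal_dist_ge_le hn (hp1 n hn) (hq1 n hn) (hp n) (hq n) hε)
    simp only [sub_zero, abs_of_nonneg (Real.sqrt_nonneg _)]

theorem tendstoInMeasure_blockDist_sqrt (hY : ∀ n, IsGaussianMatrix P (Y n))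
    (hp1 : ∀ n, 1 ≤ n → 1 ≤ p n) (hq1 : ∀ n, 1 ≤ n → 1 ≤ q n) {σ : ℝ} (hσ : 0 < σ)
    (h : Tendsto (fun n => (p n : ℝ) * (q n : ℝ) ^ 2 / (n : ℝ)) atTop (𝓝 σ))
    (hqt : Tendsto q atTop atTop) :
    TendstoInMeasure P (fun n ω => blockDist (hp n) (hq n) (Y n ω)) atTop
      (fun _ => √(σ / 2)) := by
  have hq0 : Tendsto (fun n => 1 / (q n : ℝ)) atTop (𝓝 0) :=
    tendsto_one_div_atTop_nhds_zero_nat.comp hqt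
  refine tendstoInMeasure_of_real_bound fun ε hε => ⟨fun n =>
    (p n * q n ^ 2 / n) * (1 / q n) * (2 + p n * q n ^ 2 / n : ℝ) / (ε ^ 2 / 4)
        + (40 * (p n * q n ^ 2 / n : ℝ) ^ 2 * (1 / q n)
          + 2 * (p n * q n ^ 2 / n * (1 - 1 / q n) / 2 - σ / 2) ^ 2) / (ε ^ 4 / 16), ?_, ?_⟩
  · have h1 := ((h.mul hq0).mul (h.const_add 2)).div_const (ε ^ 2 / 4)
    have h2 := ((h.pow 2).const_mul 40).mul hq0
    have h3 := (((h.mul (hq0.const_sub 1)).div_const 2).sub_const (σ / 2)).pow 2 |>.const_mul 2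
    have h4 := h1.add ((h2.add h3).div_const (ε ^ 4 / 16))
    simpa using h4
  · filter_upwards [eventually_ge_atTop 2] with n hn
    rw [measureReal_abs_blockDist_sub hY]
    exact measureReal_abs_dist_sub_ge_le hn (hp1 n (by omega)) (hq1 n (by omega)) (hp n) (hq n) hε
      (by positivity)

theorem liminf_measure_blockDist_pos (hY : ∀ n, IsGaussianMatrix P (Y n))
    (hp1 : ∀ n, 1 ≤ n → 1 ≤ p n) (hq1 : ∀ n, 1 ≤ n → 1 ≤ q n) {σ : ℝ} (hσ : 0 < σ)
    (h : Tendsto (fun n => (p n : ℝ) * (q n : ℝ) ^ 2 / (n : ℝ)) atTop (𝓝 σ))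
    {ε : ℝ} (hε : ε < √(σ / 2)) :
    0 < liminf (fun n => P {ω | ε ≤ blockDist (hp n) (hq n) (Y n ω)}) atTop := by
  -- only the positive part of `ε` matters, since the distance is nonnegative
  set e := max ε 0 with he
  have he0 : 0 ≤ e := le_max_right _ _
  have heσ : e ^ 2 < σ / 2 := by
    have h1 : e < √(σ / 2) := max_lt hε (Real.sqrt_pos.2 (by positivity))
    exact (Real.lt_sqrt he0).1 h1
  set m : ℕ → ℝ := fun n => p n * q n ^ 2 / n / 2 - 3 / 2 * (p n * q n ^ 2 / n) * (1 / n) with hm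
  set K : ℕ → ℝ := fun n => 8 * (11 * (p n * q n ^ 2 / n : ℝ) ^ 2
        + 24 * ((p n * q n ^ 2 / n) ^ 2 + 60) * (p n * q n ^ 2 / n) ^ 2) with hKdef
  have hmt : Tendsto m atTop (𝓝 (σ / 2)) := by
    have := (h.div_const 2).sub ((h.const_mul (3 / 2)).mul tendsto_one_div_atTop_nhds_zero_nat)
    simpa only [mul_zero, sub_zero] using this
  have hKt : Tendsto K atTop (𝓝 (8 * (11 * σ ^ 2 + 24 * (σ ^ 2 + 60) * σ ^ 2))) :=
    (((h.pow 2).const_mul 11).add ((((h.pow 2).add_const 60).const_mul 24).mul (h.pow 2))).const_mul 8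
  have hK0 : 0 < 8 * (11 * σ ^ 2 + 24 * (σ ^ 2 + 60) * σ ^ 2) := by positivity
  have hlim : Tendsto (fun n => (m n - e ^ 2) ^ 2 / K n) atTop
      (𝓝 ((σ / 2 - e ^ 2) ^ 2 / (8 * (11 * σ ^ 2 + 24 * (σ ^ 2 + 60) * σ ^ 2)))) :=
    ((hmt.sub_const (e ^ 2)).pow 2).div hKt hK0.ne'
  have hpos : 0 < (σ / 2 - e ^ 2) ^ 2 / (8 * (11 * σ ^ 2 + 24 * (σ ^ 2 + 60) * σ ^ 2)) :=
    div_pos (pow_pos (sub_pos.2 heσ) 2) hK0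
  obtain ⟨δ, hδ0, hδ⟩ := exists_between hpos
  refine lt_of_lt_of_le (ENNReal.ofReal_pos.2 hδ0) (le_liminf_of_le (by isBoundedDefault) ?_)
  filter_upwards [eventually_ge_atTop 2, hlim.eventually_const_lt hδ,
    hmt.eventually_const_lt heσ, hKt.eventually_const_lt hK0] with n hn h1 h2 h3
  have hset : P {ω | ε ≤ blockDist (hp n) (hq n) (Y n ω)}
      = columnLaw n {c | e ^ 2 ≤ distSq (firstIndices (hp n)) (firstIndices (hq n)) c} := by
    refine ((hY n).measure_blockDist (hp n) (hq n) (s := Set.Ici ε) measurableSet_Ici).trans ?_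
    congr 1
    ext c
    change ε ≤ √_ ↔ e ^ 2 ≤ _
    rw [← Real.le_sqrt he0 (distSq_nonneg _ _ _), he, max_le_iff]
    exact ⟨fun hx => ⟨hx, Real.sqrt_nonneg _⟩, fun hx => hx.1⟩
  rw [hset, ← ofReal_measureReal]
  refine ENNReal.ofReal_le_ofReal (h1.le.trans ?_)
  exact le_measureReal_ge (hasMoments_distSq _ _) (measurable_distSq _ _) (sq_nonneg e) h3 h2
    (le_integral_distSq_ratio hn (hq1 n (by omega)) (hp n) (hq n))
    (integral_distSq_sq_le_ratio hn (hp1 n (by omega)) (hq1 n (by omega)) (hp n) (hq n))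

end Main

end GaussOrth

theorem theorem2 {Ω : Type*} [MeasurableSpace Ω] (P : Measure Ω) [IsProbabilityMeasure P]
    (Y : (n : ℕ) → Ω → Matrix (Fin n) (Fin n) ℝ)
    (hY : ∀ n, GaussOrth.IsGaussianMatrix P (Y n)) :
    (∀ n, GaussOrth.IsHaarOrthogonalLaw
      (P.map fun ω => GaussOrth.gramSchmidtMatrix (Y n ω))) ∧
    ∀ (p q : ℕ → ℕ) (hp : ∀ n, p n ≤ n) (hq : ∀ n, q n ≤ n),
      (∀ n, 1 ≤ n → 1 ≤ p n) → (∀ n, 1 ≤ n → 1 ≤ q n) →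
      (Tendsto (fun n => (p n : ℝ) * (q n : ℝ) ^ 2 / (n : ℝ)) atTop (𝓝 0) →
        TendstoInMeasure P (fun n ω => GaussOrth.blockDist (hp n) (hq n) (Y n ω)) atTop
          (fun _ => (0 : ℝ))) ∧
      (∀ σ : ℝ, 0 < σ →
        Tendsto (fun n => (p n : ℝ) * (q n : ℝ) ^ 2 / (n : ℝ)) atTop (𝓝 σ) →
        (∀ ε : ℝ, ε < √(σ / 2) →
          0 < liminf (fun n => P {ω | ε ≤ GaussOrth.blockDist (hp n) (hq n) (Y n ω)}) atTop) ∧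
        (Tendsto q atTop atTop →
          TendstoInMeasure P (fun n ω => GaussOrth.blockDist (hp n) (hq n) (Y n ω)) atTop
            (fun _ => √(σ / 2)))) := by
  refine ⟨fun n => ?_, fun p q hp hq hp1 hq1 => ⟨fun h => ?_, fun σ hσ h => ⟨fun ε hε => ?_,
    fun hqt => ?_⟩⟩⟩
  · have hlaw := (hY n).hasLaw_column
    have h := GaussOrth.isHaarOrthogonalLaw_orthoMatrix (n := n)
    rw [← hlaw.map_eq, AEMeasurable.map_map_of_aemeasurable
      GaussOrth.measurable_orthoMatrix.aemeasurable hlaw.aemeasurable] at h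
    exact h
  · exact GaussOrth.tendstoInMeasure_blockDist_zero hp hq hY hp1 hq1 h
  · exact GaussOrth.liminf_measure_blockDist_pos hp hq hY hp1 hq1 hσ h hε
  · exact GaussOrth.tendstoInMeasure_blockDist_sqrt hp hq hY hp1 hq1 hσ h hqt
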